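/- Let $n\ge 2$, let $M$ be a smooth $n$-dimensional manifold, $T_0M=TM\setminus\{0\}$, with tangent structure $J=\frac{\partial}{\partial y^i}\otimes dx^i$ and Liouville field $\mathbb C=y^i\frac{\partial}{\partial y^i}$. Let $S$ be a spray, i.e. a smooth vector field on $T_0M$ with $JS=\mathbb C$ and $[\mathbb C,S]=S$. Put $h=\frac12(\mathrm{Id}-[S,J])$, $v=\frac12(\mathrm{Id}+[S,J])$, $\mathbb F=h\circ[S,h]-J$, $\Phi=v\circ[S,h]=R^i_j\frac{\partial}{\partial y^i}\otimes dx^j$ (brackets with $S$ are Lie derivatives), let $D_XY=h[vX,hY]+v[hX,vY]+(\mathbb F+J)[hX,JY]+J[vX,(\mathbb F+J)Y]$ be the Berwald connection, and let the Ricci scalar $\rho$ be given by $(n-1)\rho=R^i_i$. Assume that $\rho$ has no zeros on $T_0M$. A conic region is an open set $A\subseteq T_0M$ that is invariant under $(x,y)\mapsto(x,\lambda y)$, $\lambda>0$. A conic pseudo-Finsler function on $A$ is a smooth function $F:A\to(0,\infty)$ that is positively $1$-homogeneous in $y$ and for which $dd_JF^2$ is a symplectic form on $A$, where $d_Jg=dg\circ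 J$. For $U\subseteq M$ open, a Finsler function on $TU$ is a continuous function on $TU$ that vanishes on the zero section and restricts to a conic pseudo-Finsler function on $T_0U$. Such an $F$ metrizes $S$ if $i_Sdd_JF^2=-dF^2$ (on $A$, respectively on $T_0U$), and it then has non-vanishing scalar flag curvature if $\Phi=\kappa(F^2J-F\,d_JF\otimes\mathbb C)$ there, for a smooth function $\kappa$ without zeros. Consider the four conditions (i) $S$ is isotropic: $\Phi=\rho J-\alpha\otimes\mathbb C$ for a (necessarily unique) smooth semi-basic $1$-form $\alpha$ on $T_0M$; (ii) $d_J(\alpha/\rho)=0$, where $d_J\theta=i_Jd\theta-d\,i_J\theta$ for a $1$-form $\theta$; (iii) $D_{hX}(\alpha/\rho)=0$ for all vector fields $X$ on $T_0M$; (iv) the $2$-form $d(\alpha/\rho)+2\,i_{\mathbb F}(\alpha/\rho)\wedge(\alpha/\rho)$ is non-degenerate at every point of $T_0M$, where $i_{\mathbb F}\theta=\theta\circ\mathbb F$. Theorem 3.1. (a) If $S$ is metrizable by a Finsler function on $TM$ of non-vanishing scalar flag curvature, then (i)–(iv) hold. (b) If $H^1_{dR}(T_0M)=0$ and (i)–(iv)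 hold, then $S$ is metrizable by a Finsler function on $TM$ of non-vanishing scalar flag curvature. (c) With no topological assumption, (i)–(iv) hold if and only if every point of $T_0M$ lies in a conic region $A$ on which $S$ is metrizable by a conic pseudo-Finsler function of non-vanishing scalar flag curvature. (d) If $n\ge3$, then (i)–(iv) hold if and only if every point of $M$ has an open neighbourhood $U$ such that $S$ is metrizable over $U$ by a Finsler function on $TU$ of non-vanishing scalar flag curvature. -/

import Mathlib

open scoped Manifold ContDiff

noncomputable section

namespace SprayGeom

/-! ### Calculus on the coordinate space `ℝⁿ × ℝⁿ` with points `z = (x, y)`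

Tangent vectors `(a, b)` stand for `aⁱ ∂/∂xⁱ + bⁱ ∂/∂yⁱ`. All the objects below are local: their
value at `z` depends only on the germs at `z` of the fields they are built from. -/

/-- The coordinate space `ℝⁿ` of the base. -/
abbrev Base (n : ℕ) : Type := EuclideanSpace ℝ (Fin n)

/-- The coordinate space of the tangent bundle. -/
abbrev Tot (n : ℕ) : Type := Base n × Base n

variable {n : ℕ}

/-- The tangent structure `J = ∂/∂yⁱ ⊗ dxⁱ`. -/
def tangentStr (n : ℕ) : Tot n →L[ℝ] Tot n :=
  (ContinuousLinearMap.inr ℝ (Base n) (Base n)).comp (ContinuousLinearMap.fst ℝ (Base n) (Base n))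

/-- The Liouville vector field `ℂ = yⁱ ∂/∂yⁱ`. -/
def liouville (z : Tot n) : Tot n := (0, z.2)

/-- The Lie derivative (Frölicher-Nijenhuis bracket) `[S, K]` of a field of endomorphisms `K` along
a vector field `S`; it is characterized by `[S, K] X = [S, K X] - K [S, X]`, see below. -/
def lieEnd (S : Tot n → Tot n) (K : Tot n → Tot n →L[ℝ] Tot n) (z : Tot n) : Tot n →L[ℝ] Tot n :=
  fderiv ℝ K z (S z) - (fderiv ℝ S z).comp (K z) + (K z).comp (fderiv ℝ S z)

theorem lieEnd_apply (S : Tot n → Tot n) (K : Tot n → Tot n →L[ℝ] Tot n) (X : Tot n → Tot n)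
    (z : Tot n) (hK : DifferentiableAt ℝ K z) (hX : DifferentiableAt ℝ X z) :
    lieEnd S K z (X z) =
      VectorField.lieBracket ℝ S (fun w => K w (X w)) z - K z (VectorField.lieBracket ℝ S X z) := by
  simp only [lieEnd, VectorField.lieBracket, fderiv_clm_apply hK hX]
  simp
  abel

/-- The horizontal projector `h = (Id - [S, J]) / 2`. -/
def horProj (S : Tot n → Tot n) (z : Tot n) : Tot n →L[ℝ] Tot n :=
  (1 / 2 : ℝ) • (ContinuousLinearMap.id ℝ (Tot n) - lieEnd S (fun _ => tangentStr n) z)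

/-- The vertical projector `v = (Id + [S, J]) / 2`. -/
def verProj (S : Tot n → Tot n) (z : Tot n) : Tot n →L[ℝ] Tot n :=
  (1 / 2 : ℝ) • (ContinuousLinearMap.id ℝ (Tot n) + lieEnd S (fun _ => tangentStr n) z)

/-- The almost complex structure `𝔽 = h ∘ [S, h] - J`. -/
def almostCpx (S : Tot n → Tot n) (z : Tot n) : Tot n →L[ℝ] Tot n :=
  (horProj S z).comp (lieEnd S (horProj S) z) - tangentStr n

/-- The Jacobi endomorphism `Φ = v ∘ [S, h]`. -/
def jacobiEnd (S : Tot n → Tot n) (z : Tot n) : Tot n →L[ℝ] Tot n :=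
  (verProj S z).comp (lieEnd S (horProj S) z)

/-- The Ricci scalar in coordinates: `(n - 1) ρ = Rⁱᵢ`, where `Φ = Rⁱⱼ ∂/∂yⁱ ⊗ dxʲ`. -/
def localRicci (S : Tot n → Tot n) (z : Tot n) : ℝ :=
  LinearMap.trace ℝ (Base n)
    ((ContinuousLinearMap.snd ℝ (Base n) (Base n)).comp
      ((jacobiEnd S z).comp (ContinuousLinearMap.inl ℝ (Base n) (Base n)))).toLinearMap
    / ((n : ℝ) - 1)

/-- The Berwald connection
`D_X Y = h[vX, hY] + v[hX, vY] + (𝔽 + J)[hX, JY] + J[vX, (𝔽 + J)Y]`. -/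
def berwald (S X Y : Tot n → Tot n) (z : Tot n) : Tot n :=
  horProj S z (VectorField.lieBracket ℝ (fun w => verProj S w (X w))
      (fun w => horProj S w (Y w)) z)
    + verProj S z (VectorField.lieBracket ℝ (fun w => horProj S w (X w))
      (fun w => verProj S w (Y w)) z)
    + (almostCpx S z + tangentStr n) (VectorField.lieBracket ℝ (fun w => horProj S w (X w))
      (fun w => tangentStr n (Y w)) z)
    + tangentStr n (VectorField.lieBracket ℝ (fun w => verProj S w (X w))
      (fun w => (almostCpx S w + tangentStr n) (Y w)) z)

/-- The covariant derivative of a 1-form, `(D_X θ)(Y) = X(θ(Y)) - θ(D_X Y)`. -/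
def berwaldForm (S : Tot n → Tot n) (X : Tot n → Tot n) (θ : Tot n → Tot n →L[ℝ] ℝ)
    (Y : Tot n → Tot n) (z : Tot n) : ℝ :=
  fderiv ℝ (fun w => θ w (Y w)) z (X z) - θ z (berwald S X Y z)

/-- The exterior derivative of a 1-form, `dθ(a, b) = (∂ₐ θ)(b) - (∂_b θ)(a)`. -/
def extD (θ : Tot n → Tot n →L[ℝ] ℝ) (z a b : Tot n) : ℝ :=
  fderiv ℝ θ z a b - fderiv ℝ θ z b a

/-- `d_J g = dg ∘ J` for a function `g`. -/
def dJFun (g : Tot n → ℝ) (z : Tot n) : Tot n →L[ℝ] ℝ := (fderiv ℝ g z).comp (tangentStr n)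

/-- `d_J θ = i_J dθ - d i_J θ` for a 1-form `θ`. -/
def dJForm (θ : Tot n → Tot n →L[ℝ] ℝ) (z a b : Tot n) : ℝ :=
  extD θ z (tangentStr n a) b + extD θ z a (tangentStr n b)
    - extD (fun w => (θ w).comp (tangentStr n)) z a b

/-- The wedge product of two covectors, evaluated on a pair of vectors. -/
def wedge (β θ : Tot n →L[ℝ] ℝ) (a b : Tot n) : ℝ := β a * θ b - β b * θ a

/-- Non-degeneracy of a bilinear form. -/
def Nondeg (B : Tot n → Tot n → ℝ) : Prop := ∀ a, (∀ b, B a b = 0) → a = 0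

/-! ### The tangent bundle of a manifold -/

variable {M : Type*} [TopologicalSpace M] [ChartedSpace (Base n) M]
  [IsManifold 𝓘(ℝ, Base n) ∞ M]

/-- The tangent bundle `TM`. -/
abbrev TM (n : ℕ) (M : Type*) [TopologicalSpace M] [ChartedSpace (Base n) M]
    [IsManifold 𝓘(ℝ, Base n) ∞ M] : Type _ := TangentBundle 𝓘(ℝ, Base n) M

/-- The point `(x, λ y)`. -/
def scale (c : ℝ) (p : TM n M) : TM n M := ⟨p.1, c • p.2⟩

/-- The part of the slit tangent bundle over `U`. -/
def slitOver (U : Set M) : Set (TM n M) := {p | p.1 ∈ U ∧ p.2 ≠ 0}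

/-- The slit tangent bundle `T₀M`. -/
def slit : Set (TM n M) := {p | p.2 ≠ 0}

/-- The natural chart `(q, v) ↦ (xⁱ(q), yⁱ(v))` of `TM` induced by the preferred chart of `M`
at the point `x₀`. It is defined on all of the fibres over the domain of that chart. -/
def natChart (x₀ : M) : PartialEquiv (TM n M) (Tot n) :=
  extChartAt (𝓘(ℝ, Base n).tangent) (⟨x₀, 0⟩ : TM n M)

/-- The points of the natural chart at `x₀` that correspond to points of `A`. -/
def chartDom (x₀ : M) (A : Set (TM n M)) : Set (Tot n) :=
  {z | z ∈ (natChart (n := n) x₀).target ∧ (natChart x₀).symm z ∈ A}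

/-- The coordinate expression of a function on `TM`. -/
def locFun (F : TM n M → ℝ) (x₀ : M) (z : Tot n) : ℝ := F ((natChart x₀).symm z)

/-- Vector fields on `TM`; only their values on `T₀M` will matter. -/
abbrev VecField (n : ℕ) (M : Type*) [TopologicalSpace M] [ChartedSpace (Base n) M]
    [IsManifold 𝓘(ℝ, Base n) ∞ M] : Type _ :=
  ∀ p : TM n M, TangentSpace (𝓘(ℝ, Base n).tangent) p

/-- 1-forms on `TM`; only their values on `T₀M` will matter. -/
abbrev OneForm (n : ℕ) (M : Type*) [TopologicalSpace M] [ChartedSpace (Base n) M]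
    [IsManifold 𝓘(ℝ, Base n) ∞ M] : Type _ :=
  ∀ p : TM n M, TangentSpace (𝓘(ℝ, Base n).tangent) p →L[ℝ] ℝ

/-- The coordinate expression of a vector field (push-forward by the natural chart). -/
def locVec (V : VecField n M) (x₀ : M) (z : Tot n) : Tot n :=
  mfderiv (𝓘(ℝ, Base n).tangent) 𝓘(ℝ, Tot n) (natChart x₀) ((natChart x₀).symm z)
    (V ((natChart x₀).symm z))

/-- The coordinate expression of a 1-form (pull-back by the inverse of the natural chart). -/
def locForm (θ : OneForm n M) (x₀ : M) (z : Tot n) : Tot n →L[ℝ] ℝ :=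
  (θ ((natChart x₀).symm z)).comp
    (mfderiv 𝓘(ℝ, Tot n) (𝓘(ℝ, Base n).tangent) (natChart (n := n) x₀).symm z)

/-- Smoothness of a 1-form on `T₀M`. -/
def OneForm.Smooth (θ : OneForm n M) : Prop :=
  ∀ x₀ : M, ContDiffOn ℝ ∞ (locForm θ x₀) (chartDom x₀ slit)

/-- A 1-form on `T₀M` is semi-basic if it vanishes on vertical vectors. -/
def OneForm.Semibasic (θ : OneForm n M) : Prop :=
  ∀ x₀ : M, ∀ z ∈ chartDom x₀ (slit (n := n)), ∀ b : Base n, locForm θ x₀ z (0, b) = 0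

/-- A 1-form on `T₀M` is closed. -/
def OneForm.Closed (θ : OneForm n M) : Prop :=
  ∀ x₀ : M, ∀ z ∈ chartDom x₀ (slit (n := n)), ∀ a b, extD (locForm θ x₀) z a b = 0

/-- A 1-form on `T₀M` is the differential of a smooth function on `T₀M`. -/
def OneForm.Exact (θ : OneForm n M) : Prop :=
  ∃ g : TM n M → ℝ, ContMDiffOn (𝓘(ℝ, Base n).tangent) 𝓘(ℝ, ℝ) ∞ g slit ∧
    ∀ x₀ : M, ∀ z ∈ chartDom x₀ (slit (n := n)), locForm θ x₀ z = fderiv ℝ (locFun g x₀) z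

/-- The first de Rham cohomology group of `T₀M` is zero. -/
def SlitH1Vanishes (n : ℕ) (M : Type*) [TopologicalSpace M] [ChartedSpace (Base n) M]
    [IsManifold 𝓘(ℝ, Base n) ∞ M] : Prop :=
  ∀ β : OneForm n M, β.Smooth → β.Closed → β.Exact

/-! ### Sprays -/

/-- A spray: a smooth vector field `S` on `T₀M` with `J S = ℂ` and `[ℂ, S] = S`. -/
structure Spray (n : ℕ) (M : Type*) [TopologicalSpace M] [ChartedSpace (Base n) M]
    [IsManifold 𝓘(ℝ, Base n) ∞ M] where
  /-- the vector field -/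
  field : VecField n M
  smooth : ∀ x₀ : M, ContDiffOn ℝ ∞ (locVec field x₀) (chartDom x₀ slit)
  tangent : ∀ x₀ : M, ∀ z ∈ chartDom x₀ (slit (n := n)),
    tangentStr n (locVec field x₀ z) = liouville z
  homogeneous : ∀ x₀ : M, ∀ z ∈ chartDom x₀ (slit (n := n)),
    VectorField.lieBracket ℝ liouville (locVec field x₀) z = locVec field x₀ z

/-- The coordinate expression of a spray. -/
def Spray.loc (S : Spray n M) (x₀ : M) : Tot n → Tot n := locVec S.field x₀

/-- The Ricci scalar `ρ` of a spray, a function on `T₀M`. At `p` it is computed in the natural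
chart at the base point of `p`; the result is the same in every natural chart. -/
def Spray.ricci (S : Spray n M) (p : TM n M) : ℝ :=
  localRicci (S.loc p.1) (natChart p.1 p)

/-- `Φ = ρ J - α ⊗ ℂ` on `T₀M`, where `α` is a smooth semi-basic 1-form on `T₀M`. -/
structure Spray.IsotropicWith (S : Spray n M) (α : OneForm n M) : Prop where
  smooth : α.Smooth
  semibasic : α.Semibasic
  jacobi : ∀ x₀ : M, ∀ z ∈ chartDom x₀ (slit (n := n)),
    jacobiEnd (S.loc x₀) z =
      locFun S.ricci x₀ z • tangentStr n - (locForm α x₀ z).smulRight (liouville z)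

/-- The 1-form `α / ρ`. -/
def Spray.divRicci (S : Spray n M) (α : OneForm n M) : OneForm n M :=
  fun p => (S.ricci p)⁻¹ • α p

/-- `d_J θ = 0` on `T₀M`. -/
def DJClosed (θ : OneForm n M) : Prop :=
  ∀ x₀ : M, ∀ z ∈ chartDom x₀ (slit (n := n)), ∀ a b, dJForm (locForm θ x₀) z a b = 0

/-- `D_{hX} θ = 0` for all vector fields `X` on `T₀M`. -/
def Spray.HorParallel (S : Spray n M) (θ : OneForm n M) : Prop :=
  ∀ x₀ : M, ∀ X Y : Tot n → Tot n,
    ContDiffOn ℝ ∞ X (chartDom x₀ (slit (M := M))) →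
    ContDiffOn ℝ ∞ Y (chartDom x₀ (slit (M := M))) →
    ∀ z ∈ chartDom x₀ (slit (n := n)),
      berwaldForm (S.loc x₀) (fun w => horProj (S.loc x₀) w (X w)) (locForm θ x₀) Y z = 0

/-- The 2-form `dθ + 2 i_𝔽 θ ∧ θ` is non-degenerate at every point of `T₀M`; here
`i_𝔽 θ = θ ∘ 𝔽`. -/
def Spray.RegularForm (S : Spray n M) (θ : OneForm n M) : Prop :=
  ∀ x₀ : M, ∀ z ∈ chartDom x₀ (slit (n := n)),
    Nondeg fun a b => extD (locForm θ x₀) z a b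
      + 2 * wedge ((locForm θ x₀ z).comp (almostCpx (S.loc x₀) z)) (locForm θ x₀ z) a b

/-- The four conditions on a spray. The 1-form `α` is unique, since `ℂ` has no zeros on `T₀M`. -/
def Spray.FourConditions (S : Spray n M) : Prop :=
  ∃ α : OneForm n M, S.IsotropicWith α ∧ DJClosed (S.divRicci α) ∧
    S.HorParallel (S.divRicci α) ∧ S.RegularForm (S.divRicci α)

/-! ### Finsler functions -/

/-- The 2-form `d d_J F²` in coordinates. -/
def ddJSq (F : TM n M → ℝ) (x₀ : M) (z a b : Tot n) : ℝ :=
  extD (dJFun fun w => locFun F x₀ w ^ 2) z a b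

/-- `A` is an open subset of `T₀M`, invariant under `(x, y) ↦ (x, λ y)` for all `λ > 0`. -/
structure IsConicRegion (A : Set (TM n M)) : Prop where
  isOpen : IsOpen A
  subset : A ⊆ slit
  scale_mem : ∀ p ∈ A, ∀ c : ℝ, 0 < c → scale c p ∈ A

/-- `F` is a conic pseudo-Finsler function on the conic region `A` of `T₀M`. The 2-form `d d_J F²`
is exact, so that it is symplectic as soon as it is non-degenerate. -/
structure IsConicFinsler (A : Set (TM n M)) (F : TM n M → ℝ) : Prop where
  smooth : ContMDiffOn (𝓘(ℝ, Base n).tangent) 𝓘(ℝ, ℝ) ∞ F A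
  pos : ∀ p ∈ A, 0 < F p
  homogeneous : ∀ p ∈ A, ∀ c : ℝ, 0 < c → F (scale c p) = c * F p
  symplectic : ∀ x₀ : M, ∀ z ∈ chartDom x₀ A, Nondeg (ddJSq F x₀ z)

/-- `F` restricts to a Finsler function on `TU`, for an open subset `U` of `M`. -/
structure IsFinslerOver (U : Set M) (F : TM n M → ℝ) : Prop where
  continuousOn : ContinuousOn F {p | p.1 ∈ U}
  zero : ∀ x ∈ U, F ⟨x, 0⟩ = 0
  conic : IsConicFinsler (slitOver U) F

/-- `S` is the geodesic spray of `F` on `A`: `i_S d d_J F² = - d F²`. -/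
def Spray.IsGeodesicOf (S : Spray n M) (A : Set (TM n M)) (F : TM n M → ℝ) : Prop :=
  ∀ x₀ : M, ∀ z ∈ chartDom x₀ A, ∀ b : Tot n,
    ddJSq F x₀ z (S.loc x₀ z) b = - fderiv ℝ (fun w => locFun F x₀ w ^ 2) z b

/-- `F` has non-vanishing scalar flag curvature on `A`: there is a smooth function `κ` on `A`
without zeros such that `Φ = κ (F² J - F d_J F ⊗ ℂ)`. -/
def Spray.NonvanishingScalarFlag (S : Spray n M) (A : Set (TM n M)) (F : TM n M → ℝ) : Prop :=
  ∃ κ : TM n M → ℝ, ContMDiffOn (𝓘(ℝ, Base n).tangent) 𝓘(ℝ, ℝ) ∞ κ A ∧ (∀ p ∈ A, κ p ≠ 0) ∧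
    ∀ x₀ : M, ∀ z ∈ chartDom x₀ A,
      jacobiEnd (S.loc x₀) z = locFun κ x₀ z •
        (locFun F x₀ z ^ 2 • tangentStr n
          - (locFun F x₀ z • dJFun (locFun F x₀) z).smulRight (liouville z))

/-- Over the open set `U`, the spray `S` is metrizable by a Finsler function on `TU` of
non-vanishing scalar flag curvature. -/
def Spray.MetrizableOver (S : Spray n M) (U : Set M) : Prop :=
  ∃ F : TM n M → ℝ, IsFinslerOver U F ∧ S.IsGeodesicOf (slitOver U) F ∧
    S.NonvanishingScalarFlag (slitOver U) F

/-- On the conic region `A`, the spray `S` is metrizable by a conic pseudo-Finsler function of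
non-vanishing scalar flag curvature. -/
def Spray.MetrizableOnConic (S : Spray n M) (A : Set (TM n M)) : Prop :=
  ∃ F : TM n M → ℝ, IsConicFinsler A F ∧ S.IsGeodesicOf A F ∧ S.NonvanishingScalarFlag A F

end SprayGeom

end

/-!
Write `θ = α / ρ`. All four parts rest on one 1-form, the candidate `β = θ ∘ 𝔽` for the logarithmic
derivative of a Finsler function `F` that metrizes `S`.

In a chart with `S = (y, s)`, let `c = (∂s/∂y) / 2`, so that `h (a, b) = (a, c a)` and
`β (a, b) = θ (b - c a, 0)`. Three facts about `β` carry the argument.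

* If `dF = F β` and `β ∘ J = θ`, then `d d_J F² = 2 F² (dθ + 2 β ∧ θ)` (`extD_dJFun_sq`). So
  condition (iv) says exactly that `d d_J F²` is symplectic. As `θ(S) = 1` and `β(S) = 0`, the
  equation of geodesics amounts to `i_S dθ = β`, which follows from (iii) and `θ(S) = 1`
  (`IsSemibasicOn.extD_spray`).
* Under (i)-(iii) the form `β` is closed (`IsSemibasicOn.extD_comp_almostCpx`). Its
  vertical-vertical part is condition (ii), its horizontal-vertical part is condition (iii), and its
  horizontal-horizontal part is `θ` applied to the curvature of the horizontal distribution. That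
  curvature is, up to sign, a third of the skew part of the vertical derivative of the Jacobi
  endomorphism (`IsLocalSpray.fderiv_jacobiEnd_sub`), and for isotropic `S` this is killed by `θ`
  because of (ii) (`IsSemibasicOn.apply_curvature`).
* A primitive `f` of `β` on a conic region satisfies `f (x, λ y) = f (x, y) + log λ`, and
  `F = exp f` is a conic pseudo-Finsler function that metrizes `S`, with `κ = ρ / F²`
  (`Spray.ParallelIsotropic.metrizable`).

Hence sufficiency is the existence of primitives of a closed form: by hypothesis if the first
cohomology is zero, on convex sets by the Poincaré lemma, and on `B × (ℝⁿ \ {0})` with `B` a ball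
and `n ≥ 3` by gluing primitives on two star-shaped pieces that meet in a connected set. The
identity `β = i_S dθ` shows that `β` does not depend on the chart.

Conversely, if `F` metrizes `S` and `f = log F`, the equation of geodesics evaluated at `S` gives
`S f = 0`; differentiating this in vertical directions and using the equation once more gives
`df ∘ h = 0` (`IsLocalFinsler.fderiv_log_horizontal`), that is `df = β`. The conditions
(ii) and (iii) are then symmetries of the second derivative of `f`, and the isotropy form
`α = κ F d_J F` is unique, so that the local forms patch.
-/

noncomputable section

namespace SprayGeom

/-! ### The connection of a spray in a chart -/

section

variable {n : ℕ}

theorem tangentStr_apply (u : Tot n) : tangentStr n u = (0, u.1) := rfl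

theorem fderiv_fderiv_symm {E F : Type*} [NormedAddCommGroup E] [NormedSpace ℝ E]
    [NormedAddCommGroup F] [NormedSpace ℝ F] {f : E → F} {z : E} (hf : ContDiffAt ℝ ∞ f z)
    (u w : E) : fderiv ℝ (fderiv ℝ f) z u w = fderiv ℝ (fderiv ℝ f) z w u :=
  hf.isSymmSndFDerivAt (by
    rw [minSmoothness_of_isRCLikeNormedField]
    exact WithTop.coe_le_coe.2 (le_top (a := (2 : ℕ∞)))) u w

/-- The coordinate expression `S` of a spray on an open set `D` of the coordinate space. -/
structure IsLocalSpray (D : Set (Tot n)) (S : Tot n → Tot n) : Prop where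
  isOpen : IsOpen D
  smooth : ContDiffOn ℝ ∞ S D
  tangent : ∀ z ∈ D, tangentStr n (S z) = liouville z
  homogeneous : ∀ z ∈ D, VectorField.lieBracket ℝ liouville S z = S z

/-- The connection coefficients `(∂s/∂y) / 2` of `S = (y, s)`, with the sign for which
`h (a, b) = (a, connCoeff S z a)`. -/
def connCoeff (S : Tot n → Tot n) (z : Tot n) : Base n →L[ℝ] Base n :=
  (1 / 2 : ℝ) • (ContinuousLinearMap.snd ℝ (Base n) (Base n)).comp
    ((fderiv ℝ S z).comp (ContinuousLinearMap.inr ℝ (Base n) (Base n)))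

theorem connCoeff_apply (S : Tot n → Tot n) (z : Tot n) (a : Base n) :
    connCoeff S z a = (1 / 2 : ℝ) • (fderiv ℝ S z (0, a)).2 := rfl

namespace IsLocalSpray

variable {D : Set (Tot n)} {S : Tot n → Tot n} {z : Tot n}

theorem eventually (h : IsLocalSpray D S) (hz : z ∈ D) : ∀ᶠ w in nhds z, w ∈ D :=
  h.isOpen.mem_nhds hz

theorem contDiffAt (h : IsLocalSpray D S) (hz : z ∈ D) : ContDiffAt ℝ ∞ S z :=
  h.smooth.contDiffAt (h.isOpen.mem_nhds hz)

theorem differentiableAt (h : IsLocalSpray D S) (hz : z ∈ D) : DifferentiableAt ℝ S z :=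
  (h.contDiffAt hz).differentiableAt (by simp)

theorem contDiffAt_fderiv (h : IsLocalSpray D S) (hz : z ∈ D) :
    ContDiffAt ℝ ∞ (fderiv ℝ S) z :=
  (h.contDiffAt hz).fderiv_right (by simp)

theorem contDiffAt_connCoeff (h : IsLocalSpray D S) (hz : z ∈ D) :
    ContDiffAt ℝ ∞ (connCoeff S) z := by
  unfold connCoeff
  exact (contDiffAt_const.clm_comp ((h.contDiffAt_fderiv hz).clm_comp contDiffAt_const)).const_smul
    (1 / 2 : ℝ)

theorem differentiableAt_connCoeff (h : IsLocalSpray D S) (hz : z ∈ D) :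
    DifferentiableAt ℝ (connCoeff S) z :=
  (h.contDiffAt_connCoeff hz).differentiableAt (by simp)

theorem snd_snd_symm (h : IsLocalSpray D S) (hz : z ∈ D) (u w : Tot n) :
    fderiv ℝ (fderiv ℝ S) z u w = fderiv ℝ (fderiv ℝ S) z w u :=
  fderiv_fderiv_symm (h.contDiffAt hz) u w

theorem fst_apply (h : IsLocalSpray D S) (hz : z ∈ D) : (S z).1 = z.2 :=
  congrArg Prod.snd (h.tangent z hz)

theorem fderiv_fst (h : IsLocalSpray D S) (hz : z ∈ D) (u : Tot n) :
    (fderiv ℝ S z u).1 = u.2 := by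
  have h1 : (fun w => (S w).1) =ᶠ[nhds z] fun w => w.2 :=
    (h.eventually hz).mono fun w hw => h.fst_apply hw
  have h2 := h1.fderiv_eq (𝕜 := ℝ)
  have h3 := congrArg (fun L => L u) h2
  simp only [fderiv.fst (h.differentiableAt hz), fderiv_snd] at h3
  simpa using h3

theorem fderiv_connCoeff (h : IsLocalSpray D S) (hz : z ∈ D) (u : Tot n) (a : Base n) :
    fderiv ℝ (connCoeff S) z u a
      = (1 / 2 : ℝ) • (fderiv ℝ (fderiv ℝ S) z u (0, a)).2 := by
  have hd : HasFDerivAt (fderiv ℝ S) (fderiv ℝ (fderiv ℝ S) z) z :=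
    ((h.contDiffAt_fderiv hz).differentiableAt (by simp)).hasFDerivAt
  have h1 : HasFDerivAt (fun w => connCoeff S w a)
      ((1 / 2 : ℝ) • (ContinuousLinearMap.snd ℝ (Base n) (Base n)).comp
        ((fderiv ℝ (fderiv ℝ S) z).flip (0, a))) z := by
    have := (hd.clm_apply (hasFDerivAt_const (0, a) z)).snd.const_smul (1 / 2 : ℝ)
    refine this.congr_fderiv ?_
    ext v <;> simp
  have h2 := ((h.differentiableAt_connCoeff hz).hasFDerivAt.clm_apply
    (hasFDerivAt_const a z)).unique h1
  simpa using congrArg (fun L => L u) h2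

theorem fderiv_connCoeff_symm (h : IsLocalSpray D S) (hz : z ∈ D) (a b : Base n) :
    fderiv ℝ (connCoeff S) z (0, a) b = fderiv ℝ (connCoeff S) z (0, b) a := by
  rw [h.fderiv_connCoeff hz, h.fderiv_connCoeff hz, h.snd_snd_symm hz]

theorem fderiv_inr (h : IsLocalSpray D S) (hz : z ∈ D) (a : Base n) :
    fderiv ℝ S z (0, a) = (a, (2 : ℝ) • connCoeff S z a) := by
  ext1
  · rw [h.fderiv_fst hz]
  · simp [connCoeff_apply, smul_smul]

theorem horProj_apply (h : IsLocalSpray D S) (hz : z ∈ D) (u : Tot n) :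
    horProj S z u = (u.1, connCoeff S z u.1) := by
  ext1
  · simp [horProj, lieEnd, tangentStr_apply, h.fderiv_fst hz, ← two_smul ℝ, smul_smul]
  · simp [horProj, lieEnd, tangentStr_apply, h.fderiv_fst hz, connCoeff_apply]

theorem verProj_apply (h : IsLocalSpray D S) (hz : z ∈ D) (u : Tot n) :
    verProj S z u = (0, u.2 - connCoeff S z u.1) := by
  have h1 : verProj S z u = u - horProj S z u := by
    simp only [verProj, horProj, smul_apply, add_apply,
      sub_apply, ContinuousLinearMap.id_apply]
    module
  rw [h1, h.horProj_apply hz]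
  ext1 <;> simp

/-- The second component of `S` is 2-homogeneous in `y`, so that this is Euler's identity. -/
theorem connCoeff_self (h : IsLocalSpray D S) (hz : z ∈ D) :
    connCoeff S z z.2 = (S z).2 := by
  have h1 := h.homogeneous z hz
  have h2 : HasFDerivAt (liouville (n := n))
      ((ContinuousLinearMap.inr ℝ (Base n) (Base n)).comp
        (ContinuousLinearMap.snd ℝ (Base n) (Base n))) z :=
    ((ContinuousLinearMap.inr ℝ (Base n) (Base n)).comp
        (ContinuousLinearMap.snd ℝ (Base n) (Base n))).hasFDerivAt
  rw [VectorField.lieBracket, h2.fderiv] at h1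
  have h3 := congrArg Prod.snd h1
  simp only [liouville, h.fderiv_inr hz] at h3
  simp at h3
  have h4 : (2 : ℝ) • connCoeff S z z.2 = (2 : ℝ) • (S z).2 := by
    rw [sub_eq_iff_eq_add] at h3
    rw [h3, two_smul]
  exact smul_right_injective _ (two_ne_zero' ℝ) h4

/-- A spray is horizontal. -/
theorem eq_horizontal (h : IsLocalSpray D S) (hz : z ∈ D) :
    S z = (z.2, connCoeff S z z.2) :=
  Prod.ext (h.fst_apply hz) (h.connCoeff_self hz).symm

theorem fderiv_connCoeff_self (h : IsLocalSpray D S) (hz : z ∈ D) (a : Base n) :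
    fderiv ℝ (connCoeff S) z (0, a) z.2 = connCoeff S z a := by
  have h1 : (fun w => connCoeff S w w.2) =ᶠ[nhds z] fun w => (S w).2 :=
    (h.eventually hz).mono fun w hw => h.connCoeff_self hw
  have h2 := congrArg (fun L => L ((0, a) : Tot n)) (h1.fderiv_eq (𝕜 := ℝ))
  rw [fderiv_clm_apply (h.differentiableAt_connCoeff hz) differentiableAt_snd,
    fderiv.snd (h.differentiableAt hz)] at h2
  simp [fderiv_snd, h.fderiv_inr hz, two_smul] at h2
  exact h2

theorem fderiv_horProj (h : IsLocalSpray D S) (hz : z ∈ D) (u w : Tot n) :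
    fderiv ℝ (horProj S) z u w = (0, fderiv ℝ (connCoeff S) z u w.1) := by
  have hC := (h.differentiableAt_connCoeff hz).hasFDerivAt
  have h1 : horProj S =ᶠ[nhds z] fun v =>
      (ContinuousLinearMap.inl ℝ (Base n) (Base n)).comp
          (ContinuousLinearMap.fst ℝ (Base n) (Base n))
        + (ContinuousLinearMap.inr ℝ (Base n) (Base n)).comp
          ((connCoeff S v).comp (ContinuousLinearMap.fst ℝ (Base n) (Base n))) :=
    (h.eventually hz).mono fun v hv => by
      refine ContinuousLinearMap.ext fun w => ?_
      rw [h.horProj_apply hv]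
      simp
  have hd : DifferentiableAt ℝ (horProj S) z := by
    refine DifferentiableAt.congr_of_eventuallyEq ?_ h1
    have := h.differentiableAt_connCoeff hz
    fun_prop
  have h2 : (fun v => horProj S v w) =ᶠ[nhds z] fun v => (w.1, connCoeff S v w.1) :=
    (h.eventually hz).mono fun v hv => h.horProj_apply hv w
  have h3 := congrArg (fun L => L u) (h2.fderiv_eq (𝕜 := ℝ))
  rw [fderiv_clm_apply hd (differentiableAt_const w)] at h3
  rw [((hasFDerivAt_const w.1 z).prodMk (hC.clm_apply (hasFDerivAt_const w.1 z))).fderiv] at h3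
  simpa using h3

theorem lieEnd_horProj (h : IsLocalSpray D S) (hz : z ∈ D) (u : Tot n) :
    lieEnd S (horProj S) z u = (u.2 - connCoeff S z u.1,
      fderiv ℝ (connCoeff S) z (S z) u.1 - (fderiv ℝ S z (u.1, 0)).2
        - (2 : ℝ) • connCoeff S z (connCoeff S z u.1) + connCoeff S z u.2) := by
  have h1 : fderiv ℝ S z (u.1, connCoeff S z u.1)
      = fderiv ℝ S z (u.1, 0) + fderiv ℝ S z (0, connCoeff S z u.1) := by
    rw [← map_add]; simp
  ext1
  · simp [lieEnd, h.fderiv_horProj hz, h.horProj_apply hz, h.fderiv_fst hz]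
    abel
  · simp only [lieEnd, add_apply, sub_apply,
      ContinuousLinearMap.comp_apply, h.fderiv_horProj hz, h.horProj_apply hz, h.fderiv_fst hz, h1,
      h.fderiv_inr hz, Prod.snd_add, Prod.snd_sub]
    abel

theorem almostCpx_apply (h : IsLocalSpray D S) (hz : z ∈ D) (u : Tot n) :
    almostCpx S z u = (u.2 - connCoeff S z u.1,
      connCoeff S z (u.2 - connCoeff S z u.1) - u.1) := by
  simp only [almostCpx, sub_apply, ContinuousLinearMap.comp_apply,
    h.horProj_apply hz, h.lieEnd_horProj hz, tangentStr_apply]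
  ext1 <;> simp

theorem jacobiEnd_apply (h : IsLocalSpray D S) (hz : z ∈ D) (u : Tot n) :
    jacobiEnd S z u = (0, fderiv ℝ (connCoeff S) z (S z) u.1 - (fderiv ℝ S z (u.1, 0)).2
        - connCoeff S z (connCoeff S z u.1)) := by
  simp only [jacobiEnd, ContinuousLinearMap.comp_apply,
    h.verProj_apply hz, h.lieEnd_horProj hz]
  ext1
  · rfl
  · simp only [map_sub, two_smul]
    abel

end IsLocalSpray

end

/-! ### Curvature and semi-basic 1-forms in a chart -/

section

variable {n : ℕ}

/-- The curvature of the horizontal distribution: the vertical part of the bracket of the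
horizontal lifts of the constant fields `a` and `b`. -/
def curvature (S : Tot n → Tot n) (z : Tot n) (a b : Base n) : Base n :=
  fderiv ℝ (connCoeff S) z (a, connCoeff S z a) b - fderiv ℝ (connCoeff S) z (b, connCoeff S z b) a

namespace IsLocalSpray

variable {D : Set (Tot n)} {S : Tot n → Tot n} {z : Tot n}

theorem fderiv_jacobiEnd (h : IsLocalSpray D S) (hz : z ∈ D) (a b : Base n) :
    fderiv ℝ (fun w => (jacobiEnd S w (a, 0)).2) z (0, b) =
      fderiv ℝ (fderiv ℝ (connCoeff S)) z (0, b) (S z) a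
        + fderiv ℝ (connCoeff S) z (b, (2 : ℝ) • connCoeff S z b) a
        - (2 : ℝ) • fderiv ℝ (connCoeff S) z (a, 0) b
        - fderiv ℝ (connCoeff S) z (0, b) (connCoeff S z a)
        - connCoeff S z (fderiv ℝ (connCoeff S) z (0, b) a) := by
  have h1 : (fun w => (jacobiEnd S w (a, 0)).2) =ᶠ[nhds z] fun w =>
      fderiv ℝ (connCoeff S) w (S w) a - (fderiv ℝ S w (a, 0)).2
        - connCoeff S w (connCoeff S w a) :=
    (h.eventually hz).mono fun w hw => by simp only [h.jacobiEnd_apply hw]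
  have hS := (h.differentiableAt hz).hasFDerivAt
  have hC := (h.differentiableAt_connCoeff hz).hasFDerivAt
  have hDC : HasFDerivAt (fderiv ℝ (connCoeff S)) (fderiv ℝ (fderiv ℝ (connCoeff S)) z) z :=
    (((h.contDiffAt_connCoeff hz).fderiv_right (m := ∞) (by simp)).differentiableAt
      (by simp)).hasFDerivAt
  have hDS : HasFDerivAt (fderiv ℝ S) (fderiv ℝ (fderiv ℝ S) z) z :=
    ((h.contDiffAt_fderiv hz).differentiableAt (by simp)).hasFDerivAt
  have hCa := hC.clm_apply (hasFDerivAt_const a z)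
  have h2 := (((hDC.clm_apply hS).clm_apply (hasFDerivAt_const a z)).sub
    (hDS.clm_apply (hasFDerivAt_const ((a, 0) : Tot n) z)).snd).sub (hC.clm_apply hCa)
  have h3 := congrArg (fun L => L ((0, b) : Tot n)) (h1.fderiv_eq.trans h2.fderiv)
  refine h3.trans ?_
  have h4 : (2 : ℝ) • fderiv ℝ (connCoeff S) z (a, 0) b
      = (fderiv ℝ (fderiv ℝ S) z (0, b) (a, 0)).2 := by
    rw [h.fderiv_connCoeff hz, smul_smul, h.snd_snd_symm hz]
    norm_num
  rw [h4]
  simp [h.fderiv_inr hz]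
  abel

/-- The skew part of the vertical derivative of the Jacobi endomorphism is minus three times
the curvature of the horizontal distribution; the third derivatives of `S` cancel by symmetry. -/
theorem fderiv_jacobiEnd_sub (h : IsLocalSpray D S) (hz : z ∈ D) (a b : Base n) :
    fderiv ℝ (fun w => (jacobiEnd S w (a, 0)).2) z (0, b)
      - fderiv ℝ (fun w => (jacobiEnd S w (b, 0)).2) z (0, a) = -((3 : ℝ) • curvature S z a b) := by
  have hDC : DifferentiableAt ℝ (fderiv ℝ (connCoeff S)) z :=
    (((h.contDiffAt_connCoeff hz).fderiv_right (m := ∞) (by simp)).differentiableAt (by simp))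
  have hT : fderiv ℝ (fderiv ℝ (connCoeff S)) z (0, b) (S z) a
      = fderiv ℝ (fderiv ℝ (connCoeff S)) z (0, a) (S z) b := by
    have h1 : (fun w => fderiv ℝ (connCoeff S) w (0, b) a) =ᶠ[nhds z]
        fun w => fderiv ℝ (connCoeff S) w (0, a) b :=
      (h.eventually hz).mono fun w hw => h.fderiv_connCoeff_symm hw b a
    have key : ∀ a b : Base n, fderiv ℝ (fun w => fderiv ℝ (connCoeff S) w (0, b) a) z (S z)
        = fderiv ℝ (fderiv ℝ (connCoeff S)) z (0, b) (S z) a := fun a b => by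
      rw [((hDC.hasFDerivAt.clm_apply (hasFDerivAt_const ((0, b) : Tot n) z)).clm_apply
        (hasFDerivAt_const a z)).fderiv, fderiv_fderiv_symm (h.contDiffAt_connCoeff hz)]
      simp
    rw [← key, ← key, h1.fderiv_eq]
  have hlin : ∀ (a b c : Base n), fderiv ℝ (connCoeff S) z (a, b) c
      = fderiv ℝ (connCoeff S) z (a, 0) c + fderiv ℝ (connCoeff S) z (0, b) c := fun a b c => by
    rw [← add_apply, ← map_add]; simp
  have hsm : ∀ (b c : Base n), fderiv ℝ (connCoeff S) z (0, (2 : ℝ) • b) c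
      = (2 : ℝ) • fderiv ℝ (connCoeff S) z (0, b) c := fun b c => by
    rw [← smul_apply, ← map_smul]; simp
  rw [h.fderiv_jacobiEnd hz, h.fderiv_jacobiEnd hz, hT, curvature, hlin b (_ • _), hlin a (_ • _),
    hlin a (connCoeff S z a), hlin b (connCoeff S z b), hsm, hsm,
    h.fderiv_connCoeff_symm hz b (connCoeff S z a), h.fderiv_connCoeff_symm hz a (connCoeff S z b),
    h.fderiv_connCoeff_symm hz b a]
  module

end IsLocalSpray

/-- A smooth 1-form on `D` that vanishes on vertical vectors. -/
structure IsSemibasicOn (D : Set (Tot n)) (θ : Tot n → Tot n →L[ℝ] ℝ) : Prop where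
  smooth : ContDiffOn ℝ ∞ θ D
  vertical : ∀ z ∈ D, ∀ b : Base n, θ z (0, b) = 0

/-- The coordinate expression `(D_{hX} θ)(Y)` of the Berwald derivative of a semi-basic 1-form `θ`,
where `a` and `b` are the base components of `X` and `Y`. -/
def horDeriv (S : Tot n → Tot n) (θ : Tot n → Tot n →L[ℝ] ℝ) (z : Tot n) (a b : Base n) : ℝ :=
  fderiv ℝ θ z (a, connCoeff S z a) (b, 0) + θ z (fderiv ℝ (connCoeff S) z (0, b) a, 0)

namespace IsSemibasicOn

variable {D : Set (Tot n)} {S : Tot n → Tot n} {z : Tot n} {θ : Tot n → Tot n →L[ℝ] ℝ}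

theorem contDiffAt (hθ : IsSemibasicOn D θ) (hD : IsOpen D) (hz : z ∈ D) : ContDiffAt ℝ ∞ θ z :=
  hθ.smooth.contDiffAt (hD.mem_nhds hz)

theorem differentiableAt (hθ : IsSemibasicOn D θ) (hD : IsOpen D) (hz : z ∈ D) :
    DifferentiableAt ℝ θ z :=
  (hθ.contDiffAt hD hz).differentiableAt (by simp)

theorem apply_eq (hθ : IsSemibasicOn D θ) (hz : z ∈ D) (a b : Base n) :
    θ z (a, b) = θ z (a, 0) := by
  have : ((a, b) : Tot n) = (a, 0) + (0, b) := by simp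
  rw [this, map_add, hθ.vertical z hz, add_zero]

theorem fderiv_vertical (hθ : IsSemibasicOn D θ) (hD : IsOpen D) (hz : z ∈ D) (u : Tot n)
    (b : Base n) : fderiv ℝ θ z u (0, b) = 0 := by
  have h1 : (fun w => θ w (0, b)) =ᶠ[nhds z] fun _ => 0 :=
    Filter.mem_of_superset (hD.mem_nhds hz) fun w hw => hθ.vertical w hw b
  have h2 := congrArg (fun L => L u) (h1.fderiv_eq (𝕜 := ℝ))
  rw [((hθ.differentiableAt hD hz).hasFDerivAt.clm_apply
    (hasFDerivAt_const ((0, b) : Tot n) z)).fderiv] at h2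
  simpa using h2

theorem fderiv_apply_eq (hθ : IsSemibasicOn D θ) (hD : IsOpen D) (hz : z ∈ D) (u : Tot n)
    (a b : Base n) : fderiv ℝ θ z u (a, b) = fderiv ℝ θ z u (a, 0) := by
  have : ((a, b) : Tot n) = (a, 0) + (0, b) := by simp
  rw [this, map_add, hθ.fderiv_vertical hD hz, add_zero]

theorem dJForm_eq (hθ : IsSemibasicOn D θ) (hD : IsOpen D) (hz : z ∈ D) (u w : Tot n) :
    dJForm θ z u w = fderiv ℝ θ z (0, u.1) (w.1, 0) - fderiv ℝ θ z (0, w.1) (u.1, 0) := by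
  have h1 : (fun w => (θ w).comp (tangentStr n)) =ᶠ[nhds z] fun _ => 0 :=
    Filter.mem_of_superset (hD.mem_nhds hz) fun w hw => by
      refine ContinuousLinearMap.ext fun v => ?_
      exact hθ.vertical w hw v.1
  have e1 := hθ.fderiv_apply_eq hD hz (0, u.1) w.1 w.2
  have e2 := hθ.fderiv_apply_eq hD hz (0, w.1) u.1 u.2
  simp only [dJForm, extD, h1.fderiv_eq, tangentStr_apply, hθ.fderiv_vertical hD hz]
  rw [← e1, ← e2]
  simp
  ring

theorem berwaldForm_eq (hθ : IsSemibasicOn D θ) (h : IsLocalSpray D S) (hz : z ∈ D)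
    {X Y : Tot n → Tot n} (hX : DifferentiableAt ℝ X z) (hY : DifferentiableAt ℝ Y z) :
    berwaldForm S (fun w => horProj S w (X w)) θ Y z = horDeriv S θ z (X z).1 (Y z).1 := by
  have hD := h.isOpen
  have hC := (h.differentiableAt_connCoeff hz).hasFDerivAt
  have hθd := (hθ.differentiableAt hD hz).hasFDerivAt
  have e1 : (fun w => verProj S w (horProj S w (X w))) =ᶠ[nhds z] fun _ => 0 :=
    (h.eventually hz).mono fun w hw => by
      simp [h.verProj_apply hw, h.horProj_apply hw]
  have e2 : (fun w => horProj S w (horProj S w (X w))) =ᶠ[nhds z]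
      fun w => ((X w).1, connCoeff S w (X w).1) :=
    (h.eventually hz).mono fun w hw => by
      simp [h.horProj_apply hw]
  have e3 : θ z (berwald S (fun w => horProj S w (X w)) Y z)
      = θ z (fderiv ℝ (fun w => (Y w).1) z ((X z).1, connCoeff S z (X z).1)
        - fderiv ℝ (connCoeff S) z (0, (Y z).1) (X z).1, 0) := by
    have f1 : HasFDerivAt (fun w => tangentStr n (Y w)) ((tangentStr n).comp (fderiv ℝ Y z)) z :=
      (tangentStr n).hasFDerivAt.comp z hY.hasFDerivAt
    have f2 := hX.hasFDerivAt.fst.prodMk (hC.clm_apply hX.hasFDerivAt.fst)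
    have b1 : VectorField.lieBracket ℝ (fun w => verProj S w (horProj S w (X w)))
        (fun w => horProj S w (Y w)) z = 0 := by
      rw [VectorField.lieBracket, e1.fderiv_eq, e1.eq_of_nhds]
      simp
    have b3 : VectorField.lieBracket ℝ (fun w => horProj S w (horProj S w (X w)))
        (fun w => tangentStr n (Y w)) z
        = (-(fderiv ℝ X z (0, (Y z).1)).1, (fderiv ℝ Y z ((X z).1, connCoeff S z (X z).1)).1
          - fderiv ℝ (connCoeff S) z (0, (Y z).1) (X z).1
          - connCoeff S z (fderiv ℝ X z (0, (Y z).1)).1) := by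
      rw [VectorField.lieBracket, e2.fderiv_eq, e2.eq_of_nhds, f1.fderiv, f2.fderiv]
      ext1
      · simp [tangentStr_apply]
      · simp [tangentStr_apply]
        abel
    rw [berwald, b1, b3]
    simp only [map_add, h.verProj_apply hz, add_apply, h.almostCpx_apply hz, tangentStr_apply,
      hθ.vertical z hz, fderiv.fst hY, map_zero, ContinuousLinearMap.comp_apply]
    rw [hθ.apply_eq hz]
    simp only [zero_add, add_zero, map_neg]
    congr 2
    simp
  have e4 := hθd.clm_apply hY.hasFDerivAt
  have e5 := hθ.apply_eq hz (fderiv ℝ Y z ((X z).1, connCoeff S z (X z).1)).1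
    (fderiv ℝ Y z ((X z).1, connCoeff S z (X z).1)).2
  have e6 := hθ.fderiv_apply_eq hD hz ((X z).1, connCoeff S z (X z).1) (Y z).1 (Y z).2
  rw [berwaldForm, e4.fderiv, e3, horDeriv]
  have e7 : ∀ a b : Base n, θ z (a - b, 0) = θ z (a, 0) - θ z (b, 0) := fun a b => by
    rw [← map_sub]; simp
  simp only [h.horProj_apply hz, fderiv.fst hY, e7, ContinuousLinearMap.comp_apply,
    ContinuousLinearMap.flip_apply, add_apply, ContinuousLinearMap.coe_fst', Prod.mk.eta]
    at e5 e6 ⊢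
  rw [e5, e6]
  ring

/-- The form `θ ∘ 𝔽` is closed as soon as `θ` is `d_J`-closed, horizontally parallel, and vanishes
on the curvature. -/
theorem extD_comp_almostCpx (hθ : IsSemibasicOn D θ) (h : IsLocalSpray D S) (hz : z ∈ D)
    (hJ : ∀ a b, fderiv ℝ θ z (0, a) (b, 0) = fderiv ℝ θ z (0, b) (a, 0))
    (hH : ∀ a b, horDeriv S θ z a b = 0) (hK : ∀ a b, θ z (curvature S z a b, 0) = 0)
    (u w : Tot n) :
    extD (fun v => (θ v).comp (almostCpx S v)) z u w = 0 := by
  have hD := h.isOpen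
  have hC := (h.differentiableAt_connCoeff hz).hasFDerivAt
  have hθd := (hθ.differentiableAt hD hz).hasFDerivAt
  have e1 : (fun v => (θ v).comp (almostCpx S v)) =ᶠ[nhds z] fun v =>
      (θ v).comp ((ContinuousLinearMap.inl ℝ (Base n) (Base n)).comp
        (ContinuousLinearMap.snd ℝ (Base n) (Base n)
          - (connCoeff S v).comp (ContinuousLinearMap.fst ℝ (Base n) (Base n)))) :=
    (h.eventually hz).mono fun v hv => by
      refine ContinuousLinearMap.ext fun w => ?_
      simp only [ContinuousLinearMap.comp_apply, h.almostCpx_apply hv]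
      exact hθ.apply_eq hv _ _
  have hd : DifferentiableAt ℝ (fun v => (θ v).comp (almostCpx S v)) z := by
    refine DifferentiableAt.congr_of_eventuallyEq ?_ e1
    have := hC.differentiableAt
    have := hθd.differentiableAt
    fun_prop
  have key : ∀ u w, fderiv ℝ (fun v => (θ v).comp (almostCpx S v)) z u w
      = fderiv ℝ θ z u (w.2 - connCoeff S z w.1, 0)
        - θ z (fderiv ℝ (connCoeff S) z u w.1, 0) := fun u w => by
    have f1 : (fun v => (θ v).comp (almostCpx S v) w) =ᶠ[nhds z]
        fun v => θ v (w.2 - connCoeff S v w.1, 0) :=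
      (h.eventually hz).mono fun v hv => by
        simp only [ContinuousLinearMap.comp_apply, h.almostCpx_apply hv]
        exact hθ.apply_eq hv _ _
    have f2 := f1.fderiv_eq (𝕜 := ℝ)
    have f3 : HasFDerivAt (fun v => ((w.2 - connCoeff S v w.1, 0) : Tot n)) _ z :=
      ((hasFDerivAt_const w.2 z).sub (hC.clm_apply (hasFDerivAt_const w.1 z))).prodMk
        (hasFDerivAt_const (0 : Base n) z)
    rw [(hd.hasFDerivAt.clm_apply (hasFDerivAt_const w z)).fderiv,
      (hθd.clm_apply f3).fderiv] at f2
    have f4 := congrArg (fun L => L u) f2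
    simp at f4
    have f5 := map_neg (θ z) (fderiv ℝ (connCoeff S) z u w.1, 0)
    rw [Prod.neg_mk, neg_zero] at f5
    rw [f4, f5]
    ring
  -- Splitting `u` and `w` into horizontal and vertical parts reduces the claim to the hypotheses.
  obtain ⟨a, a', rfl⟩ : ∃ a a', u = (a, connCoeff S z a + a') :=
    ⟨u.1, u.2 - connCoeff S z u.1, by simp⟩
  obtain ⟨b, b', rfl⟩ : ∃ b b', w = (b, connCoeff S z b + b') :=
    ⟨w.1, w.2 - connCoeff S z w.1, by simp⟩
  rw [extD, key, key]
  have hlin : ∀ a a' : Base n, ((a, connCoeff S z a + a') : Tot n)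
      = (a, connCoeff S z a) + (0, a') := fun a a' => by simp
  have hadd : ∀ a a' : Base n, θ z (a + a', 0) = θ z (a, 0) + θ z (a', 0) := fun a a' => by
    rw [← map_add]; simp
  have hsub : ∀ a a' : Base n, θ z (a - a', 0) = θ z (a, 0) - θ z (a', 0) := fun a a' => by
    rw [← map_sub]; simp
  have h1 := hH a b'
  have h2 := hH b a'
  have h3 := hJ a' b'
  have h4 := hK a b
  rw [horDeriv] at h1 h2
  rw [curvature, hsub] at h4
  simp only [hlin, map_add, add_apply, hadd, add_sub_cancel_left]
  linarith

end IsSemibasicOn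

end

/-! ### Isotropic sprays and the candidate for `d log F` in a chart -/

section

variable {n : ℕ}

variable {D : Set (Tot n)} {S : Tot n → Tot n} {z : Tot n} {θ : Tot n → Tot n →L[ℝ] ℝ}

/-- The Jacobi endomorphism vanishes on the spray: `Rⁱⱼ yʲ = 0`. -/
theorem IsLocalSpray.jacobiEnd_self (h : IsLocalSpray D S) (hz : z ∈ D) :
    jacobiEnd S z (z.2, 0) = 0 := by
  have h1 : (fun w => connCoeff S w w.2) =ᶠ[nhds z] fun w => (S w).2 :=
    (h.eventually hz).mono fun w hw => h.connCoeff_self hw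
  have h2 := congrArg (fun L => L (S z)) (h1.fderiv_eq (𝕜 := ℝ))
  rw [fderiv_clm_apply (h.differentiableAt_connCoeff hz) differentiableAt_snd,
    fderiv.snd (h.differentiableAt hz)] at h2
  have h3 : fderiv ℝ S z (S z) = fderiv ℝ S z (z.2, 0) + fderiv ℝ S z (0, (S z).2) := by
    rw [← map_add]; simp [← h.fst_apply hz]
  simp [fderiv_snd, h3, h.fderiv_inr hz, two_smul] at h2
  rw [h.jacobiEnd_apply hz]
  ext1
  · rfl
  · simp only [h.connCoeff_self hz, Prod.snd_zero]
    rw [← sub_eq_zero] at h2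
    refine Eq.trans ?_ h2
    abel

namespace IsSemibasicOn

/-- If the spray is isotropic with `α = ρ θ`, then the `d_J`-closed form `θ` vanishes on the
curvature. -/
theorem apply_curvature (hθ : IsSemibasicOn D θ) (h : IsLocalSpray D S) (hz : z ∈ D)
    {ρ : Tot n → ℝ} (hρ : DifferentiableAt ℝ ρ z) (h1 : θ z (z.2, 0) = 1)
    (hR : ∀ w ∈ D, ∀ a, (jacobiEnd S w (a, 0)).2 = ρ w • a - (ρ w * θ w (a, 0)) • w.2)
    (hJ : ∀ a b, fderiv ℝ θ z (0, a) (b, 0) = fderiv ℝ θ z (0, b) (a, 0)) (a b : Base n) :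
    θ z (curvature S z a b, 0) = 0 := by
  have hθd := (hθ.differentiableAt h.isOpen hz).hasFDerivAt
  have key : ∀ a b : Base n, fderiv ℝ (fun w => (jacobiEnd S w (a, 0)).2) z (0, b)
      = fderiv ℝ ρ z (0, b) • a - ((ρ z * θ z (a, 0)) • b
        + (ρ z * fderiv ℝ θ z (0, b) (a, 0) + fderiv ℝ ρ z (0, b) * θ z (a, 0)) • z.2) := by
    intro a b
    have e1 : (fun w => (jacobiEnd S w (a, 0)).2) =ᶠ[nhds z]
        fun w => ρ w • a - (ρ w * θ w (a, 0)) • w.2 :=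
      (h.eventually hz).mono fun w hw => hR w hw a
    have e2 := (hρ.hasFDerivAt.smul (hasFDerivAt_const a z)).sub
      ((hρ.hasFDerivAt.mul (hθd.clm_apply (hasFDerivAt_const ((a, 0) : Tot n) z))).smul
        (hasFDerivAt_snd (𝕜 := ℝ) (p := z)))
    refine (congrArg (fun L => L ((0, b) : Tot n)) (e1.fderiv_eq.trans e2.fderiv)).trans ?_
    simp
    module
  have h2 := h.fderiv_jacobiEnd_sub hz a b
  rw [key, key] at h2
  have h3 := congrArg (fun v => θ z (v, 0)) h2
  have hL : ∀ v, θ z (v, 0) = ((θ z).comp (ContinuousLinearMap.inl ℝ (Base n) (Base n))) v :=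
    fun _ => rfl
  simp only [hL, map_sub, map_add, map_smul, map_neg, smul_eq_mul] at h3 ⊢
  simp only [← hL, h1, hJ a b] at h3 ⊢
  linarith

/-- `i_S dθ = θ ∘ 𝔽`. The left-hand side uses only `S` and `d`, hence is natural under changes of
charts. -/
theorem extD_spray (hθ : IsSemibasicOn D θ) (h : IsLocalSpray D S) (hz : z ∈ D)
    (h1 : ∀ w ∈ D, θ w (w.2, 0) = 1)
    (hH : ∀ a b, horDeriv S θ z a b = 0) (u : Tot n) :
    extD θ z (S z) u = θ z (almostCpx S z u) := by
  have hD := h.isOpen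
  have hθd := (hθ.differentiableAt hD hz).hasFDerivAt
  have e1 : ∀ b : Base n, fderiv ℝ θ z (0, b) (z.2, 0) = - θ z (b, 0) := fun b => by
    have f1 : (fun w => θ w (w.2, 0)) =ᶠ[nhds z] fun _ => 1 :=
      (h.eventually hz).mono fun w hw => h1 w hw
    have f2 := f1.fderiv_eq (𝕜 := ℝ)
    rw [(hθd.clm_apply ((hasFDerivAt_snd (𝕜 := ℝ) (p := z)).prodMk
      (hasFDerivAt_const (0 : Base n) z))).fderiv] at f2
    have f3 := congrArg (fun L => L ((0, b) : Tot n)) f2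
    simp at f3
    linarith
  obtain ⟨a, b, rfl⟩ : ∃ a b, u = (a, connCoeff S z a + b) :=
    ⟨u.1, u.2 - connCoeff S z u.1, by simp⟩
  have e2 := hH z.2 a
  have e3 := hH a z.2
  rw [horDeriv] at e2 e3
  rw [← h.eq_horizontal hz, h.fderiv_connCoeff_self hz] at e2
  rw [h.fderiv_connCoeff_symm hz, h.fderiv_connCoeff_self hz] at e3
  have e4 : ((a, connCoeff S z a + b) : Tot n) = (a, connCoeff S z a) + (0, b) := by simp
  have e5 := hθ.fderiv_apply_eq hD hz (a, connCoeff S z a) (S z).1 (S z).2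
  have e6 := hθ.fderiv_apply_eq hD hz (0, b) (S z).1 (S z).2
  have e7 := hθ.fderiv_apply_eq hD hz (S z) a (connCoeff S z a)
  have e8 := hθ.fderiv_vertical hD hz (S z) b
  have e9 := e1 b
  rw [Prod.mk.eta, h.fst_apply hz] at e5 e6
  rw [h.almostCpx_apply hz, hθ.apply_eq hz, extD, e4]
  simp only [map_add, add_apply, Prod.fst_add, Prod.snd_add, add_zero, add_sub_cancel_left]
  rw [e5, e6, e7, e8, e9]
  linarith

end IsSemibasicOn

/-- If `β = d log F` and `θ = β ∘ J`, then `d d_J F² = 2 F² (dθ + 2 β ∧ θ)`. -/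
theorem extD_dJFun_sq {F : Tot n → ℝ} {β θ : Tot n → Tot n →L[ℝ] ℝ}
    (hF : ∀ᶠ w in nhds z, HasFDerivAt F (F w • β w) w)
    (hβ : ∀ᶠ w in nhds z, (β w).comp (tangentStr n) = θ w) (hθ : DifferentiableAt ℝ θ z)
    (u w : Tot n) : extD (dJFun fun v => F v ^ 2) z u w
      = 2 * F z ^ 2 * (extD θ z u w + 2 * wedge (β z) (θ z) u w) := by
  have h1 : (dJFun fun v => F v ^ 2) =ᶠ[nhds z] fun v => (2 * F v ^ 2) • θ v := by
    filter_upwards [hF, hβ] with v hv hv'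
    rw [dJFun, (hv.pow 2).fderiv, ← hv']
    refine ContinuousLinearMap.ext fun x => ?_
    simp
    ring
  have h2 : HasFDerivAt (fun v => (2 * F v ^ 2) • θ v) _ z :=
    ((hF.self_of_nhds.pow 2).const_mul 2).smul hθ.hasFDerivAt
  rw [extD, h1.fderiv_eq, h2.fderiv, extD, wedge]
  simp
  ring

end

/-! ### Metrizable sprays in a chart -/

section

variable {n : ℕ}

variable {D : Set (Tot n)} {S : Tot n → Tot n} {z : Tot n}

/-- The coordinate expression of a conic pseudo-Finsler function whose geodesic spray is `S`.
Homogeneity enters through Euler's identity only, and non-degeneracy is left out. -/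
structure IsLocalFinsler (D : Set (Tot n)) (S : Tot n → Tot n) (F : Tot n → ℝ) : Prop where
  smooth : ContDiffOn ℝ ∞ F D
  pos : ∀ z ∈ D, 0 < F z
  euler : ∀ z ∈ D, fderiv ℝ F z (0, z.2) = F z
  geodesic : ∀ z ∈ D, ∀ b, extD (dJFun fun w => F w ^ 2) z (S z) b
    = -fderiv ℝ (fun w => F w ^ 2) z b

theorem fderiv_dJFun {f : Tot n → ℝ} (hf : ContDiffAt ℝ ∞ f z) (u w : Tot n) :
    fderiv ℝ (dJFun f) z u w = fderiv ℝ (fderiv ℝ f) z u (0, w.1) := by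
  have h1 : HasFDerivAt (fderiv ℝ f) (fderiv ℝ (fderiv ℝ f) z) z :=
    ((hf.fderiv_right (m := ∞) (by simp)).differentiableAt (by simp)).hasFDerivAt
  have h2 : HasFDerivAt (dJFun f) _ z := h1.clm_comp (hasFDerivAt_const (tangentStr n) z)
  rw [h2.fderiv]
  simp [tangentStr_apply]

namespace IsLocalFinsler

variable {F : Tot n → ℝ}

theorem contDiffAt_log (hF : IsLocalFinsler D S F) (h : IsLocalSpray D S) (hz : z ∈ D) :
    ContDiffAt ℝ ∞ (fun w => Real.log (F w)) z :=
  (hF.smooth.contDiffAt (h.isOpen.mem_nhds hz)).log (hF.pos z hz).ne'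

theorem hasFDerivAt (hF : IsLocalFinsler D S F) (h : IsLocalSpray D S) (hz : z ∈ D) :
    HasFDerivAt F (F z • fderiv ℝ (fun w => Real.log (F w)) z) z := by
  have h1 : HasFDerivAt F (fderiv ℝ F z) z :=
    ((hF.smooth.contDiffAt (h.isOpen.mem_nhds hz)).differentiableAt (by simp)).hasFDerivAt
  rw [(h1.log (hF.pos z hz).ne').fderiv, smul_smul, mul_inv_cancel₀ (hF.pos z hz).ne', one_smul]
  exact h1

theorem isSemibasicOn (hF : IsLocalFinsler D S F) (h : IsLocalSpray D S) :
    IsSemibasicOn D (dJFun fun w => Real.log (F w)) where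
  smooth := fun w hw => (((hF.contDiffAt_log h hw).fderiv_right (m := ∞) (by simp)).clm_comp
    contDiffAt_const).contDiffWithinAt
  vertical := fun w _ b => by
    have : tangentStr n (0, b) = 0 := rfl
    rw [dJFun, ContinuousLinearMap.comp_apply, this, map_zero]

theorem euler_log (hF : IsLocalFinsler D S F) (h : IsLocalSpray D S) (hz : z ∈ D) :
    fderiv ℝ (fun w => Real.log (F w)) z (0, z.2) = 1 := by
  have h1 := hF.euler z hz
  rw [(hF.hasFDerivAt h hz).fderiv] at h1
  have h2 := hF.pos z hz
  simp at h1
  field_simp at h1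
  exact h1

theorem extD_sq (hF : IsLocalFinsler D S F) (h : IsLocalSpray D S) (hz : z ∈ D) (u w : Tot n) :
    extD (dJFun fun v => F v ^ 2) z u w = 2 * F z ^ 2 *
      (extD (dJFun fun w => Real.log (F w)) z u w
        + 2 * wedge (fderiv ℝ (fun w => Real.log (F w)) z) (dJFun (fun w => Real.log (F w)) z)
          u w) :=
  extD_dJFun_sq ((h.eventually hz).mono fun _ hv => hF.hasFDerivAt h hv)
    (Filter.Eventually.of_forall fun _ => rfl)
    ((hF.isSemibasicOn h).differentiableAt h.isOpen hz) u w

/-- The equation of geodesics, written for `log F` instead of `F²`. -/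
theorem geodesic_log (hF : IsLocalFinsler D S F) (h : IsLocalSpray D S) (hz : z ∈ D) (b : Tot n) :
    extD (dJFun fun w => Real.log (F w)) z (S z) b
      + 2 * fderiv ℝ (fun w => Real.log (F w)) z (S z)
        * fderiv ℝ (fun w => Real.log (F w)) z (0, b.1)
      = fderiv ℝ (fun w => Real.log (F w)) z b := by
  have h1 := hF.geodesic z hz b
  have h2 := hF.pos z hz
  have h3 : (dJFun (fun w => Real.log (F w)) z) (S z) = 1 := by
    rw [← hF.euler_log h hz]
    simp [dJFun, tangentStr_apply, h.fst_apply hz]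
  have h4 : (dJFun (fun w => Real.log (F w)) z) b
    = fderiv ℝ (fun w => Real.log (F w)) z (0, b.1) := rfl
  have hp : fderiv ℝ (fun w => F w ^ 2) z b
      = 2 * F z ^ 2 * fderiv ℝ (fun w => Real.log (F w)) z b := by
    rw [((hF.hasFDerivAt h hz).pow 2).fderiv]
    simp
    ring
  rw [hF.extD_sq h hz, wedge, h3, h4, hp] at h1
  have h5 : 2 * F z ^ 2 ≠ 0 := by positivity
  rw [← mul_neg] at h1
  have h6 := mul_left_cancel₀ h5 h1
  linarith

theorem fderiv_log_spray (hF : IsLocalFinsler D S F) (h : IsLocalSpray D S) (hz : z ∈ D) :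
    fderiv ℝ (fun w => Real.log (F w)) z (S z) = 0 := by
  have h1 := hF.geodesic_log h hz (S z)
  rw [h.fst_apply hz, hF.euler_log h hz, extD] at h1
  linarith

/-- A Finsler function is constant along the horizontal distribution of its geodesic spray. This
is the vertical derivative of `S (log F) = 0`, combined with the equation of geodesics. -/
theorem fderiv_log_horizontal (hF : IsLocalFinsler D S F) (h : IsLocalSpray D S) (hz : z ∈ D)
    (a : Base n) : fderiv ℝ (fun w => Real.log (F w)) z (a, connCoeff S z a) = 0 := by
  set f := fun w => Real.log (F w) with hf
  have hfz := hF.contDiffAt_log h hz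
  have hd : HasFDerivAt (fderiv ℝ f) (fderiv ℝ (fderiv ℝ f) z) z :=
    ((hfz.fderiv_right (m := ∞) (by simp)).differentiableAt (by simp)).hasFDerivAt
  have hS := (h.differentiableAt hz).hasFDerivAt
  have e1 : fderiv ℝ (fderiv ℝ f) z (0, a) (S z) + fderiv ℝ f z (a, (2 : ℝ) • connCoeff S z a)
      = 0 := by
    have f1 : (fun w => fderiv ℝ f w (S w)) =ᶠ[nhds z] fun _ => 0 :=
      (h.eventually hz).mono fun w hw => hF.fderiv_log_spray h hw
    have f2 := congrArg (fun L => L ((0, a) : Tot n)) (f1.fderiv_eq (𝕜 := ℝ))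
    rw [(hd.clm_apply hS).fderiv] at f2
    simp [h.fderiv_inr hz] at f2
    linarith
  have e2 : fderiv ℝ (fderiv ℝ f) z (a, 0) (0, z.2) = 0 := by
    have f1 : (fun w => fderiv ℝ f w (0, w.2)) =ᶠ[nhds z] fun _ => 1 :=
      (h.eventually hz).mono fun w hw => hF.euler_log h hw
    have f2 := congrArg (fun L => L ((a, 0) : Tot n)) (f1.fderiv_eq (𝕜 := ℝ))
    rw [(hd.clm_apply ((hasFDerivAt_const (0 : Base n) z).prodMk
      (hasFDerivAt_snd (𝕜 := ℝ) (p := z)))).fderiv] at f2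
    simpa [← Prod.zero_eq_mk] using f2
  have e3 := hF.geodesic_log h hz (a, 0)
  rw [hF.fderiv_log_spray h hz, extD, fderiv_dJFun hfz, fderiv_dJFun hfz, h.fst_apply hz, e2,
    fderiv_fderiv_symm hfz (S z)] at e3
  have e4 : (2 : ℝ) * fderiv ℝ f z (a, connCoeff S z a)
      = fderiv ℝ f z (a, 0) + fderiv ℝ f z (a, (2 : ℝ) • connCoeff S z a) := by
    rw [← map_add, ← smul_eq_mul, ← map_smul]
    simp [two_smul]
  linarith

/-- `d log F = θ ∘ 𝔽` for `θ = d_J log F`. -/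
theorem fderiv_log_eq (hF : IsLocalFinsler D S F) (h : IsLocalSpray D S) (hz : z ∈ D) :
    fderiv ℝ (fun w => Real.log (F w)) z
      = (dJFun (fun w => Real.log (F w)) z).comp (almostCpx S z) := by
  refine ContinuousLinearMap.ext fun u => ?_
  have h1 : u = (u.1, connCoeff S z u.1) + (0, u.2 - connCoeff S z u.1) := by simp
  rw [dJFun, ContinuousLinearMap.comp_apply, ContinuousLinearMap.comp_apply, tangentStr_apply,
    h.almostCpx_apply hz]
  conv_lhs => rw [h1]
  rw [map_add, hF.fderiv_log_horizontal h hz, zero_add]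

theorem fderiv_vertical_symm (hF : IsLocalFinsler D S F) (h : IsLocalSpray D S) (hz : z ∈ D)
    (a b : Base n) : fderiv ℝ (dJFun fun w => Real.log (F w)) z (0, a) (b, 0)
      = fderiv ℝ (dJFun fun w => Real.log (F w)) z (0, b) (a, 0) := by
  have hfz := hF.contDiffAt_log h hz
  rw [fderiv_dJFun hfz, fderiv_dJFun hfz, fderiv_fderiv_symm hfz]

theorem horDeriv_eq_zero (hF : IsLocalFinsler D S F) (h : IsLocalSpray D S) (hz : z ∈ D)
    (a b : Base n) : horDeriv S (dJFun fun w => Real.log (F w)) z a b = 0 := by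
  have hfz := hF.contDiffAt_log h hz
  have hd : HasFDerivAt (fderiv ℝ fun w => Real.log (F w)) _ z :=
    ((hfz.fderiv_right (m := ∞) (by simp)).differentiableAt (by simp)).hasFDerivAt
  have f1 : (fun w => fderiv ℝ (fun w => Real.log (F w)) w (a, connCoeff S w a))
      =ᶠ[nhds z] fun _ => 0 :=
    (h.eventually hz).mono fun w hw => hF.fderiv_log_horizontal h hw a
  have f2 := congrArg (fun L => L ((0, b) : Tot n)) (f1.fderiv_eq (𝕜 := ℝ))
  rw [(hd.clm_apply ((hasFDerivAt_const a z).prodMk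
    ((h.differentiableAt_connCoeff hz).hasFDerivAt.clm_apply
      (hasFDerivAt_const a z)))).fderiv] at f2
  rw [horDeriv, fderiv_dJFun hfz, fderiv_fderiv_symm hfz]
  simp at f2
  rw [dJFun, ContinuousLinearMap.comp_apply, tangentStr_apply]
  linarith

end IsLocalFinsler

end

/-! ### Natural charts of the tangent bundle and their transition maps -/

section

variable {n : ℕ} {M : Type*} [TopologicalSpace M] [ChartedSpace (Base n) M]
  [IsManifold 𝓘(ℝ, Base n) ∞ M]

theorem mem_natChart_source {x₀ : M} {p : TM n M} :
    p ∈ (natChart (n := n) x₀).source ↔ p.1 ∈ (chartAt (Base n) x₀).source := by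
  simp [natChart]

theorem mem_natChart_target {x₀ : M} {z : Tot n} :
    z ∈ (natChart (n := n) x₀).target ↔ z.1 ∈ (chartAt (Base n) x₀).target := by
  rw [natChart, extChartAt_target, ModelWithCorners.range_eq_univ, Set.inter_univ]
  exact TangentBundle.mem_chart_target_iff (I := 𝓘(ℝ, Base n)) z (⟨x₀, 0⟩ : TM n M)

theorem natChart_apply (x₀ : M) (p : TM n M) :
    natChart x₀ p = (extChartAt 𝓘(ℝ, Base n) x₀ p.1,
      tangentCoordChange 𝓘(ℝ, Base n) p.1 x₀ p.1 p.2) := rfl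

theorem natChart_symm_apply (x₀ : M) (z : Tot n) :
    (natChart x₀).symm z = ⟨(extChartAt 𝓘(ℝ, Base n) x₀).symm z.1,
      tangentCoordChange 𝓘(ℝ, Base n) x₀ ((extChartAt 𝓘(ℝ, Base n) x₀).symm z.1)
        ((extChartAt 𝓘(ℝ, Base n) x₀).symm z.1) z.2⟩ := rfl

theorem isOpen_natChart_target (x₀ : M) : IsOpen (natChart (n := n) x₀).target :=
  isOpen_extChartAt_target _

theorem isOpen_natChart_source (x₀ : M) : IsOpen (natChart (n := n) x₀).source :=
  isOpen_extChartAt_source _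

theorem contMDiffAt_natChart {x₀ : M} {p : TM n M} (hp : p ∈ (natChart (n := n) x₀).source) :
    ContMDiffAt (𝓘(ℝ, Base n).tangent) 𝓘(ℝ, Tot n) ∞ (natChart (n := n) x₀) p :=
  contMDiffAt_extChartAt' (by simpa [natChart] using hp)

theorem contMDiffAt_natChart_symm {x₀ : M} {z : Tot n}
    (hz : z ∈ (natChart (n := n) x₀).target) :
    ContMDiffAt 𝓘(ℝ, Tot n) (𝓘(ℝ, Base n).tangent) ∞ (natChart (n := n) x₀).symm z :=
  (contMDiffOn_extChartAt_symm (n := ∞) _).contMDiffAt ((isOpen_natChart_target x₀).mem_nhds hz)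

/-- The change of natural charts from `x₀` to `x₁`. -/
def chartTrans (x₀ x₁ : M) (z : Tot n) : Tot n := natChart x₁ ((natChart x₀).symm z)

section Trans

variable {x₀ x₁ : M} {z : Tot n}

theorem natChart_symm_mem (hz : z ∈ (natChart (n := n) x₀).target) :
    (natChart x₀).symm z ∈ (natChart (n := n) x₀).source := PartialEquiv.map_target _ hz

theorem eventually_symm_mem (hz : z ∈ (natChart (n := n) x₀).target) {A : Set (TM n M)}
    (hA : IsOpen A) (hzA : (natChart x₀).symm z ∈ A) :
    ∀ᶠ w in nhds z, w ∈ (natChart (n := n) x₀).target ∧ (natChart x₀).symm w ∈ A :=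
  Filter.inter_mem ((isOpen_natChart_target x₀).mem_nhds hz)
    ((contMDiffAt_natChart_symm hz).continuousAt.preimage_mem_nhds (hA.mem_nhds hzA))

theorem chartTrans_eq (hz : z ∈ (natChart (n := n) x₀).target)
    (hz1 : (natChart x₀).symm z ∈ (natChart (n := n) x₁).source) :
    chartTrans x₀ x₁ z = (extChartAt 𝓘(ℝ, Base n) x₁ ((extChartAt 𝓘(ℝ, Base n) x₀).symm z.1),
      tangentCoordChange 𝓘(ℝ, Base n) x₀ x₁ ((extChartAt 𝓘(ℝ, Base n) x₀).symm z.1) z.2) := by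
  rw [chartTrans, natChart_apply]
  ext1
  · rfl
  · refine tangentCoordChange_comp ⟨⟨?_, ?_⟩, ?_⟩
    · have := natChart_symm_mem hz
      rw [mem_natChart_source] at this
      rwa [extChartAt_source]
    · exact mem_extChartAt_source _
    · rw [mem_natChart_source] at hz1
      rwa [extChartAt_source]

theorem contDiffAt_chartTrans (hz : z ∈ (natChart (n := n) x₀).target)
    (hz1 : (natChart x₀).symm z ∈ (natChart (n := n) x₁).source) :
    ContDiffAt ℝ ∞ (chartTrans x₀ x₁ : Tot n → Tot n) z :=
  ((contMDiffAt_natChart hz1).comp z (contMDiffAt_natChart_symm hz)).contDiffAt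

theorem chartTrans_mem (hz1 : (natChart x₀).symm z ∈ (natChart (n := n) x₁).source) :
    chartTrans x₀ x₁ z ∈ (natChart (n := n) x₁).target := PartialEquiv.map_source _ hz1

theorem natChart_symm_chartTrans (hz1 : (natChart x₀).symm z ∈ (natChart (n := n) x₁).source) :
    (natChart x₁).symm (chartTrans x₀ x₁ z) = (natChart x₀).symm z := PartialEquiv.left_inv _ hz1

/-- The tangent structure `J` is the same in all natural charts, since the changes of charts are
`(x, y) ↦ (ψ x, Dψ(x) y)`. -/
theorem fderiv_chartTrans_tangentStr (hz : z ∈ (natChart (n := n) x₀).target)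
    (hz1 : (natChart x₀).symm z ∈ (natChart (n := n) x₁).source) (u : Tot n) :
    fderiv ℝ (chartTrans x₀ x₁) z (tangentStr n u)
      = tangentStr n (fderiv ℝ (chartTrans x₀ x₁) z u) := by
  have hd := (contDiffAt_chartTrans hz hz1).differentiableAt (by simp)
  set q : M := (extChartAt 𝓘(ℝ, Base n) x₀).symm z.1 with hq
  have hev := eventually_symm_mem hz (isOpen_natChart_source x₁) hz1
  have hz' := mem_natChart_target.1 hz
  have e1 : HasFDerivAt (fun w : Tot n => (chartTrans x₀ x₁ w).1)
      ((tangentCoordChange 𝓘(ℝ, Base n) x₀ x₁ q).comp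
        (ContinuousLinearMap.fst ℝ (Base n) (Base n))) z := by
    have f1 := hasFDerivWithinAt_tangentCoordChange (I := 𝓘(ℝ, Base n)) (x := x₀) (y := x₁)
      (z := q) ⟨by
        have := natChart_symm_mem hz
        rw [mem_natChart_source] at this
        rwa [extChartAt_source], by
        rw [mem_natChart_source] at hz1
        rwa [extChartAt_source]⟩
    rw [ModelWithCorners.range_eq_univ, hasFDerivWithinAt_univ, hq,
      PartialEquiv.right_inv _ (by simpa using hz')] at f1
    exact f1.comp z hasFDerivAt_fst
  have e2 : (fun t : ℝ => chartTrans x₀ x₁ (z + t • (0, u.1))) =ᶠ[nhds 0]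
      fun t => ((extChartAt 𝓘(ℝ, Base n) x₁ q),
        tangentCoordChange 𝓘(ℝ, Base n) x₀ x₁ q (z.2 + t • u.1)) := by
    have hc : Filter.Tendsto (fun t : ℝ => z + t • ((0, u.1) : Tot n)) (nhds 0) (nhds z) := by
      have : Continuous (fun t : ℝ => z + t • ((0, u.1) : Tot n)) := by fun_prop
      simpa using this.tendsto 0
    filter_upwards [hc.eventually hev] with t ht
    rw [chartTrans_eq ht.1 ht.2]
    simp [hq]
  have e3 : HasDerivAt (fun t : ℝ => chartTrans x₀ x₁ (z + t • ((0, u.1) : Tot n)))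
      (fderiv ℝ (chartTrans x₀ x₁) z (0, u.1)) 0 := by
    have g1 : HasDerivAt (fun t : ℝ => z + t • ((0, u.1) : Tot n)) (0, u.1) 0 := by
      simpa using ((hasDerivAt_id (0 : ℝ)).smul_const ((0, u.1) : Tot n)).const_add z
    have g2 : HasFDerivAt (chartTrans x₀ x₁) (fderiv ℝ (chartTrans x₀ x₁) z)
        (z + (0 : ℝ) • ((0, u.1) : Tot n)) := by
      simpa using hd.hasFDerivAt
    exact g2.comp_hasDerivAt 0 g1
  have e4 : HasDerivAt (fun t : ℝ => ((extChartAt 𝓘(ℝ, Base n) x₁ q,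
        tangentCoordChange 𝓘(ℝ, Base n) x₀ x₁ q (z.2 + t • u.1)) : Tot n))
      (0, tangentCoordChange 𝓘(ℝ, Base n) x₀ x₁ q u.1) 0 := by
    refine (hasDerivAt_const (0 : ℝ) _).prodMk ?_
    refine (tangentCoordChange 𝓘(ℝ, Base n) x₀ x₁ q).hasFDerivAt.comp_hasDerivAt 0 ?_
    simpa using ((hasDerivAt_id (0 : ℝ)).smul_const u.1).const_add z.2
  have e5 := e3.unique (e4.congr_of_eventuallyEq e2)
  have e6 := (hd.hasFDerivAt.fst).unique e1
  rw [tangentStr_apply, tangentStr_apply, e5]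
  exact congrArg (fun v => ((0, v) : Tot n)) (congrArg (fun L => L u) e6).symm

theorem locVec_chartTrans (V : VecField n M) (hz : z ∈ (natChart (n := n) x₀).target)
    (hz1 : (natChart x₀).symm z ∈ (natChart (n := n) x₁).source) :
    locVec V x₁ (chartTrans x₀ x₁ z) = fderiv ℝ (chartTrans x₀ x₁) z (locVec V x₀ z) := by
  have hp := natChart_symm_mem hz
  have e0 := PartialEquiv.right_inv _ hz
  have e1 : (natChart x₁ : TM n M → Tot n) =ᶠ[nhds ((natChart x₀).symm z)]
      chartTrans x₀ x₁ ∘ natChart x₀ := by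
    filter_upwards [(isOpen_natChart_source x₀).mem_nhds hp] with p hp
    simp [chartTrans, PartialEquiv.left_inv _ hp]
  have hd := (contDiffAt_chartTrans hz hz1).differentiableAt (by simp)
  rw [locVec, natChart_symm_chartTrans hz1, locVec, e1.mfderiv_eq, mfderiv_comp (I' := 𝓘(ℝ, Tot n)),
    mfderiv_eq_fderiv, e0]
  · rfl
  · rw [e0]; exact hd.mdifferentiableAt
  · exact (contMDiffAt_natChart hp).mdifferentiableAt (by simp)

theorem locForm_chartTrans (θ : OneForm n M) (hz : z ∈ (natChart (n := n) x₀).target)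
    (hz1 : (natChart x₀).symm z ∈ (natChart (n := n) x₁).source) :
    locForm θ x₀ z
      = (locForm θ x₁ (chartTrans x₀ x₁ z)).comp (fderiv ℝ (chartTrans x₀ x₁) z) := by
  have e1 : ((natChart x₀).symm : Tot n → TM n M) =ᶠ[nhds z]
      (natChart x₁).symm ∘ chartTrans x₀ x₁ := by
    filter_upwards [eventually_symm_mem hz (isOpen_natChart_source x₁) hz1] with w hw
    exact (natChart_symm_chartTrans hw.2).symm
  have hd := (contDiffAt_chartTrans hz hz1).differentiableAt (by simp)
  rw [locForm, locForm, natChart_symm_chartTrans hz1, e1.mfderiv_eq,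
    mfderiv_comp (I' := 𝓘(ℝ, Tot n)), mfderiv_eq_fderiv]
  · rfl
  · exact (contMDiffAt_natChart_symm (chartTrans_mem hz1)).mdifferentiableAt (by simp)
  · exact hd.mdifferentiableAt

theorem locFun_eventuallyEq (F : TM n M → ℝ) (hz : z ∈ (natChart (n := n) x₀).target)
    (hz1 : (natChart x₀).symm z ∈ (natChart (n := n) x₁).source) :
    locFun F x₀ =ᶠ[nhds z] locFun F x₁ ∘ chartTrans x₀ x₁ := by
  filter_upwards [eventually_symm_mem hz (isOpen_natChart_source x₁) hz1] with w hw
  simp [locFun, natChart_symm_chartTrans hw.2]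

end Trans

/-- The 1-form whose value at `p` is computed from a chart-dependent family `η` in the natural chart
at the base point of `p`. -/
def ofChartForms (η : M → Tot n → Tot n →L[ℝ] ℝ) : OneForm n M := fun p =>
  (η p.1 (natChart p.1 p)).comp
    (mfderiv (𝓘(ℝ, Base n).tangent) 𝓘(ℝ, Tot n) (natChart (n := n) p.1) p)

theorem locForm_ofChartForms (η : M → Tot n → Tot n →L[ℝ] ℝ) {x₀ : M} {z : Tot n}
    (hz : z ∈ (natChart (n := n) x₀).target) :
    locForm (ofChartForms η) x₀ z
      = (η ((natChart x₀).symm z).1 (chartTrans x₀ ((natChart x₀).symm z).1 z)).comp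
        (fderiv ℝ (chartTrans x₀ ((natChart x₀).symm z).1) z) := by
  have hz1 : (natChart x₀).symm z ∈ (natChart (n := n) ((natChart x₀).symm z).1).source := by
    rw [mem_natChart_source]; exact mem_chart_source _ _
  have hd := (contDiffAt_chartTrans hz hz1).differentiableAt (by simp)
  have e2 : fderiv ℝ (chartTrans x₀ ((natChart x₀).symm z).1) z
    = (mfderiv (𝓘(ℝ, Base n).tangent) 𝓘(ℝ, Tot n) (natChart (n := n) ((natChart x₀).symm z).1)
        ((natChart x₀).symm z)).comp
      (mfderiv 𝓘(ℝ, Tot n) (𝓘(ℝ, Base n).tangent) (natChart (n := n) x₀).symm z) := by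
    rw [← mfderiv_eq_fderiv]
    exact mfderiv_comp z ((contMDiffAt_natChart hz1).mdifferentiableAt (by simp))
      ((contMDiffAt_natChart_symm hz).mdifferentiableAt (by simp))
  rw [e2]
  rfl

end

/-! ### Sprays and functions on the tangent bundle in natural charts -/

section

variable {n : ℕ} {M : Type*} [TopologicalSpace M] [ChartedSpace (Base n) M]
  [IsManifold 𝓘(ℝ, Base n) ∞ M] {x₀ : M} {z : Tot n} {A : Set (TM n M)}

theorem natChart_scale (x₀ : M) (c : ℝ) (p : TM n M) :
    natChart x₀ (scale c p) = ((natChart x₀ p).1, c • (natChart x₀ p).2) := by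
  ext1
  · rfl
  · exact map_smul (tangentCoordChange 𝓘(ℝ, Base n) p.1 x₀ p.1) c p.2

theorem natChart_symm_smul (x₀ : M) (c : ℝ) (z : Tot n) :
    (natChart x₀).symm (z.1, c • z.2) = scale c ((natChart x₀).symm z) := by
  rw [natChart_symm_apply, natChart_symm_apply]
  exact congrArg (fun v => (⟨_, v⟩ : TM n M)) (map_smul (tangentCoordChange 𝓘(ℝ, Base n) x₀
    ((extChartAt 𝓘(ℝ, Base n) x₀).symm z.1) ((extChartAt 𝓘(ℝ, Base n) x₀).symm z.1)) c z.2)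

theorem natChart_snd_eq_zero {p : TM n M} (hp : p ∈ (natChart (n := n) x₀).source) :
    (natChart x₀ p).2 = 0 ↔ p.2 = 0 := by
  constructor
  · intro h
    have h1 : natChart x₀ p = natChart x₀ (scale 0 p) := by
      rw [natChart_scale, zero_smul, ← h]
    have h2 := (natChart (n := n) x₀).injOn hp
      (mem_natChart_source.2 (mem_natChart_source.1 hp : (scale 0 p).1 ∈ _)) h1
    rw [h2]
    exact zero_smul ℝ p.2
  · intro h
    rw [natChart_apply, h]
    exact map_zero (tangentCoordChange 𝓘(ℝ, Base n) p.1 x₀ p.1)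

theorem natChart_symm_mem_slit (hz : z ∈ (natChart (n := n) x₀).target) :
    (natChart x₀).symm z ∈ slit (n := n) (M := M) ↔ z.2 ≠ 0 := by
  change ¬ _ = _ ↔ _
  rw [← natChart_snd_eq_zero (natChart_symm_mem hz),
    PartialEquiv.right_inv _ hz]

theorem isOpen_slit : IsOpen (slit : Set (TM n M)) := by
  rw [isOpen_iff_mem_nhds]
  intro p hp
  have hps : p ∈ (natChart (n := n) p.1).source := by
    rw [mem_natChart_source]; exact mem_chart_source _ _
  have h1 := (contMDiffAt_natChart hps).continuousAt.snd
  have h2 : (natChart p.1 p).2 ≠ 0 := by rwa [ne_eq, natChart_snd_eq_zero hps]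
  filter_upwards [h1.eventually_ne h2, (isOpen_natChart_source p.1).mem_nhds hps] with q hq hqs
  exact fun h => hq ((natChart_snd_eq_zero hqs).2 h)

theorem isOpen_slitOver {U : Set M} (hU : IsOpen U) : IsOpen (slitOver U : Set (TM n M)) :=
  (hU.preimage (FiberBundle.continuous_proj (Base n) _)).inter isOpen_slit

theorem slitOver_subset (U : Set M) : (slitOver U : Set (TM n M)) ⊆ slit := fun _ hp => hp.2

theorem isConicRegion_slitOver {U : Set M} (hU : IsOpen U) :
    IsConicRegion (slitOver U : Set (TM n M)) where
  isOpen := isOpen_slitOver hU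
  subset := slitOver_subset U
  scale_mem := fun _ hp _ hc => ⟨hp.1, (smul_ne_zero hc.ne' hp.2 :)⟩

theorem mem_natChart_source_self (p : TM n M) : p ∈ (natChart (n := n) p.1).source := by
  rw [mem_natChart_source]; exact mem_chart_source _ _

theorem isOpen_chartDom (x₀ : M) (hA : IsOpen A) : IsOpen (chartDom x₀ A) := by
  rw [isOpen_iff_mem_nhds]
  exact fun z hz => eventually_symm_mem hz.1 hA hz.2

theorem chartDom_mono {B : Set (TM n M)} (h : A ⊆ B) (x₀ : M) : chartDom x₀ A ⊆ chartDom x₀ B :=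
  fun _ hz => ⟨hz.1, h hz.2⟩

theorem snd_ne_zero_of_mem_chartDom (hz : z ∈ chartDom x₀ (slit : Set (TM n M))) : z.2 ≠ 0 :=
  (natChart_symm_mem_slit hz.1).1 hz.2

theorem natChart_mem_chartDom {p : TM n M} (hp : p ∈ A) (hp' : p ∈ (natChart (n := n) x₀).source) :
    natChart x₀ p ∈ chartDom x₀ A :=
  ⟨PartialEquiv.map_source _ hp', by rwa [PartialEquiv.left_inv _ hp']⟩

theorem chartTrans_mem_chartDom {x₁ : M} (hz : z ∈ chartDom x₀ A)
    (hz1 : (natChart x₀).symm z ∈ (natChart (n := n) x₁).source) :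
    chartTrans x₀ x₁ z ∈ chartDom x₁ A := natChart_mem_chartDom hz.2 hz1

theorem Spray.isLocalSpray (S : Spray n M) (x₀ : M) (hA : IsOpen A) (hAs : A ⊆ slit) :
    IsLocalSpray (chartDom x₀ A) (S.loc x₀) where
  isOpen := isOpen_chartDom x₀ hA
  smooth := (S.smooth x₀).mono (chartDom_mono hAs x₀)
  tangent := fun z hz => S.tangent x₀ z (chartDom_mono hAs x₀ hz)
  homogeneous := fun z hz => S.homogeneous x₀ z (chartDom_mono hAs x₀ hz)

theorem contDiffOn_locFun {F : TM n M → ℝ} (hA : IsOpen A)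
    (hF : ContMDiffOn (𝓘(ℝ, Base n).tangent) 𝓘(ℝ, ℝ) ∞ F A) (x₀ : M) :
    ContDiffOn ℝ ∞ (locFun F x₀) (chartDom x₀ A) := fun z hz =>
  (((hF.contMDiffAt (hA.mem_nhds hz.2)).comp z
    (contMDiffAt_natChart_symm hz.1)).contDiffAt).contDiffWithinAt

theorem contMDiffAt_of_locFun {F : TM n M → ℝ} {p : TM n M}
    (hp : p ∈ (natChart (n := n) x₀).source)
    (hF : ContDiffAt ℝ ∞ (locFun F x₀) (natChart x₀ p)) :
    ContMDiffAt (𝓘(ℝ, Base n).tangent) 𝓘(ℝ, ℝ) ∞ F p := by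
  refine (hF.contMDiffAt.comp p (contMDiffAt_natChart hp)).congr_of_eventuallyEq ?_
  filter_upwards [(isOpen_natChart_source x₀).mem_nhds hp] with q hq
  simp [locFun, PartialEquiv.left_inv _ hq]

theorem fderiv_locFun_euler {F : TM n M → ℝ} (hA : IsOpen A)
    (hF : ContMDiffOn (𝓘(ℝ, Base n).tangent) 𝓘(ℝ, ℝ) ∞ F A)
    (hh : ∀ p ∈ A, ∀ c : ℝ, 0 < c → F (scale c p) = c * F p) (hz : z ∈ chartDom x₀ A) :
    fderiv ℝ (locFun F x₀) z (0, z.2) = locFun F x₀ z := by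
  have hd : HasFDerivAt (locFun F x₀) (fderiv ℝ (locFun F x₀) z) z :=
    (((contDiffOn_locFun hA hF x₀).contDiffAt
      ((isOpen_chartDom x₀ hA).mem_nhds hz)).differentiableAt (by simp)).hasFDerivAt
  have h1 : HasDerivAt (fun c : ℝ => ((z.1, c • z.2) : Tot n)) (0, z.2) 1 := by
    refine (hasDerivAt_const (1 : ℝ) z.1).prodMk ?_
    simpa using (hasDerivAt_id (1 : ℝ)).smul_const z.2
  have h2 : HasDerivAt (fun c : ℝ => locFun F x₀ (z.1, c • z.2))
      (fderiv ℝ (locFun F x₀) z (0, z.2)) 1 := by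
    have : HasFDerivAt (locFun F x₀) (fderiv ℝ (locFun F x₀) z) (z.1, (1 : ℝ) • z.2) := by
      simpa using hd
    exact this.comp_hasDerivAt 1 h1
  have h3 : (fun c : ℝ => locFun F x₀ (z.1, c • z.2)) =ᶠ[nhds 1]
      fun c => c * locFun F x₀ z := by
    filter_upwards [lt_mem_nhds (zero_lt_one' ℝ)] with c hc
    rw [locFun, natChart_symm_smul, hh _ hz.2 c hc]
    rfl
  have h4 : HasDerivAt (fun c : ℝ => c * locFun F x₀ z) (locFun F x₀ z) 1 := by
    simpa using (hasDerivAt_id (1 : ℝ)).mul_const (locFun F x₀ z)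
  exact h2.unique (h4.congr_of_eventuallyEq h3)

theorem IsConicFinsler.isLocalFinsler {S : Spray n M} {F : TM n M → ℝ} (hF : IsConicFinsler A F)
    (hA : IsOpen A) (hS : S.IsGeodesicOf A F) (x₀ : M) :
    IsLocalFinsler (chartDom x₀ A) (S.loc x₀) (locFun F x₀) where
  smooth := contDiffOn_locFun hA hF.smooth x₀
  pos := fun _ hz => hF.pos _ hz.2
  euler := fun _ hz => fderiv_locFun_euler hA hF.smooth hF.homogeneous hz
  geodesic := hS x₀

/-- The trace that defines the Ricci scalar, for an endomorphism of isotropic shape. -/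
theorem localRicci_of_jacobiEnd {S : Tot n → Tot n} (hn : 2 ≤ n) {c : ℝ} {β : Tot n →L[ℝ] ℝ}
    (hΦ : jacobiEnd S z = c • tangentStr n - β.smulRight (liouville z)) (hβ : β (z.2, 0) = c) :
    localRicci S z = c := by
  have h1 : ((ContinuousLinearMap.snd ℝ (Base n) (Base n)).comp
      ((jacobiEnd S z).comp (ContinuousLinearMap.inl ℝ (Base n) (Base n)))).toLinearMap
      = c • LinearMap.id
        - ((β.comp (ContinuousLinearMap.inl ℝ (Base n) (Base n))).toLinearMap).smulRight z.2 := by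
    ext1 a
    simp [hΦ, tangentStr_apply, liouville]
  have h2 : (n : ℝ) - 1 ≠ 0 := by
    have : (2 : ℝ) ≤ n := by exact_mod_cast hn
    linarith
  have h3 := LinearMap.trace_smulRight (R := ℝ)
    ((β.comp (ContinuousLinearMap.inl ℝ (Base n) (Base n))).toLinearMap) z.2
  rw [localRicci, h1, map_sub, map_smul, LinearMap.trace_id, finrank_euclideanSpace,
    Fintype.card_fin, h3]
  simp [hβ]
  field_simp

end

/-! ### Necessity of the four conditions -/

section

variable {n : ℕ} {M : Type*} [TopologicalSpace M] [ChartedSpace (Base n) M]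
  [IsManifold 𝓘(ℝ, Base n) ∞ M] {x₀ : M} {z : Tot n} {A : Set (TM n M)}

theorem fderiv_locFun_chartTrans {F : TM n M → ℝ} {x₁ : M}
    (hz : z ∈ (natChart (n := n) x₀).target)
    (hz1 : (natChart x₀).symm z ∈ (natChart (n := n) x₁).source)
    (hF : DifferentiableAt ℝ (locFun F x₁) (chartTrans x₀ x₁ z)) :
    fderiv ℝ (locFun F x₀) z
      = (fderiv ℝ (locFun F x₁) (chartTrans x₀ x₁ z)).comp (fderiv ℝ (chartTrans x₀ x₁) z) := by
  rw [(locFun_eventuallyEq F hz hz1).fderiv_eq, fderiv_comp z hF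
    ((contDiffAt_chartTrans hz hz1).differentiableAt (by simp))]

theorem dJFun_locFun_chartTrans {F : TM n M → ℝ} {x₁ : M}
    (hz : z ∈ (natChart (n := n) x₀).target)
    (hz1 : (natChart x₀).symm z ∈ (natChart (n := n) x₁).source)
    (hF : DifferentiableAt ℝ (locFun F x₁) (chartTrans x₀ x₁ z)) :
    dJFun (locFun F x₀) z
      = (dJFun (locFun F x₁) (chartTrans x₀ x₁ z)).comp (fderiv ℝ (chartTrans x₀ x₁) z) := by
  rw [dJFun, fderiv_locFun_chartTrans hz hz1 hF]
  refine ContinuousLinearMap.ext fun u => ?_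
  simp only [dJFun, ContinuousLinearMap.comp_apply, fderiv_chartTrans_tangentStr hz hz1]

theorem Spray.jacobiEnd_of_flag {S : Spray n M} {F κ : TM n M → ℝ}
    (hΦ : jacobiEnd (S.loc x₀) z = locFun κ x₀ z • (locFun F x₀ z ^ 2 • tangentStr n
          - (locFun F x₀ z • dJFun (locFun F x₀) z).smulRight (liouville z))) :
    jacobiEnd (S.loc x₀) z = (locFun κ x₀ z * locFun F x₀ z ^ 2) • tangentStr n
          - ((locFun κ x₀ z * locFun F x₀ z) • dJFun (locFun F x₀) z).smulRight (liouville z) := by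
  rw [hΦ]
  refine ContinuousLinearMap.ext fun u => ?_
  simp [smul_sub, smul_smul, mul_assoc]

theorem Spray.ricci_eq_of_flag {S : Spray n M} (hn : 2 ≤ n) {F κ : TM n M → ℝ} (hA : IsOpen A)
    (hF : IsConicFinsler A F)
    (hΦ : ∀ x₀ : M, ∀ z ∈ chartDom x₀ A, jacobiEnd (S.loc x₀) z = locFun κ x₀ z •
        (locFun F x₀ z ^ 2 • tangentStr n
          - (locFun F x₀ z • dJFun (locFun F x₀) z).smulRight (liouville z)))
    {p : TM n M} (hp : p ∈ A) : S.ricci p = κ p * F p ^ 2 := by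
  have hz := natChart_mem_chartDom hp (mem_natChart_source_self p)
  have h1 : ∀ G : TM n M → ℝ, locFun G p.1 (natChart p.1 p) = G p := fun G => by
    rw [locFun, PartialEquiv.left_inv _ (mem_natChart_source_self p)]
  rw [Spray.ricci, localRicci_of_jacobiEnd hn (Spray.jacobiEnd_of_flag (hΦ p.1 _ hz)), h1, h1]
  have h2 := fderiv_locFun_euler hA hF.smooth hF.homogeneous hz
  simp only [smul_apply, dJFun, ContinuousLinearMap.comp_apply, tangentStr_apply, h2, smul_eq_mul]
  ring

/-- The 1-form of an isotropic spray is unique, as `ℂ` has no zeros on `T₀M`. -/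
theorem smulRight_liouville_injective (hz : z.2 ≠ 0) {β γ : Tot n →L[ℝ] ℝ} {L : Tot n →L[ℝ] Tot n}
    (h : L - β.smulRight (liouville z) = L - γ.smulRight (liouville z)) : β = γ := by
  refine ContinuousLinearMap.ext fun u => ?_
  have h1 := congrArg (fun L => (L u).2) (sub_right_injective h)
  exact smul_left_injective ℝ hz h1

/-- A spray that is metrizable near every point of `T₀M`, with non-vanishing scalar flag curvature,
satisfies the four conditions. -/
theorem Spray.fourConditions_of_conic (S : Spray n M) (hn : 2 ≤ n)
    (H : ∀ p ∈ slit (n := n) (M := M), ∃ A : Set (TM n M),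
        IsConicRegion A ∧ p ∈ A ∧ S.MetrizableOnConic A) : S.FourConditions := by
  choose! A hA hpA F hF hG κ hκ hκ0 hΦ using H
  -- The isotropy form at `p` is `κ F d_J F`, for the functions `F` and `κ` chosen for `p`.
  let η : M → Tot n → Tot n →L[ℝ] ℝ := fun x z =>
    (κ ((natChart x).symm z) ((natChart x).symm z) * F ((natChart x).symm z) ((natChart x).symm z))
      • dJFun (locFun (F ((natChart x).symm z)) x) z
  let α : OneForm n M := ofChartForms η
  have hric : ∀ q ∈ slit, ∀ p ∈ A q, S.ricci p = κ q p * F q p ^ 2 := fun q hq p hp =>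
    Spray.ricci_eq_of_flag hn (hA q hq).isOpen (hF q hq) (hΦ q hq) hp
  have hα0 : ∀ x₀ : M, ∀ z ∈ chartDom x₀ (slit (n := n)), ∀ p, p = (natChart x₀).symm z →
      locForm α x₀ z = (κ p p * F p p) • dJFun (locFun (F p) x₀) z := by
    rintro x₀ z hz p hp
    have hz1 : (natChart x₀).symm z ∈ (natChart (n := n) p.1).source :=
      hp ▸ mem_natChart_source_self _
    have hpA' := hpA p (hp ▸ hz.2)
    have hzA : z ∈ chartDom x₀ (A p) := ⟨hz.1, hp ▸ hpA'⟩
    have hd : DifferentiableAt ℝ (locFun (F p) p.1) (chartTrans x₀ p.1 z) :=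
      ((contDiffOn_locFun (hA p (hp ▸ hz.2)).isOpen (hF p (hp ▸ hz.2)).smooth p.1).contDiffAt
        ((isOpen_chartDom p.1 (hA p (hp ▸ hz.2)).isOpen).mem_nhds
          (chartTrans_mem_chartDom hzA hz1))).differentiableAt (by simp)
    rw [locForm_ofChartForms η hz.1, ← hp]
    simp only [η, natChart_symm_chartTrans hz1, ← hp]
    rw [dJFun_locFun_chartTrans hz.1 hz1 hd]
    rfl
  have hΦ' : ∀ q ∈ slit, ∀ x₀ : M, ∀ z ∈ chartDom x₀ (A q), jacobiEnd (S.loc x₀) z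
      = locFun S.ricci x₀ z • tangentStr n - ((locFun (κ q) x₀ z * locFun (F q) x₀ z)
        • dJFun (locFun (F q) x₀) z).smulRight (liouville z) := fun q hq x₀ z hz => by
    rw [Spray.jacobiEnd_of_flag (hΦ q hq x₀ z hz), locFun, locFun, locFun, ← hric q hq _ hz.2]
  -- By uniqueness of the isotropy form, the functions chosen for a nearby point give the same form.
  have hα : ∀ q ∈ slit, ∀ x₀ : M, ∀ z ∈ chartDom x₀ (A q),
      locForm α x₀ z = (locFun (κ q) x₀ z * locFun (F q) x₀ z) • dJFun (locFun (F q) x₀) z := by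
    intro q hq x₀ z hz
    have hzs : z ∈ chartDom x₀ slit := chartDom_mono (hA q hq).subset x₀ hz
    rw [hα0 x₀ z hzs _ rfl]
    refine smulRight_liouville_injective (snd_ne_zero_of_mem_chartDom hzs)
      (L := locFun S.ricci x₀ z • tangentStr n) ?_
    rw [← hΦ' q hq x₀ z hz]
    exact (hΦ' _ hzs.2 x₀ z ⟨hz.1, hpA _ hzs.2⟩).symm
  have hθ : ∀ q ∈ slit, ∀ x₀ : M, ∀ z ∈ chartDom x₀ (A q),
      locForm (S.divRicci α) x₀ z = dJFun (fun w => Real.log (locFun (F q) x₀ w)) z := by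
    intro q hq x₀ z hz
    have hL := (hF q hq).isLocalFinsler (hA q hq).isOpen (hG q hq) x₀
    have hS := S.isLocalSpray x₀ (hA q hq).isOpen (hA q hq).subset
    have e1 : locForm (S.divRicci α) x₀ z = (S.ricci ((natChart x₀).symm z))⁻¹ • locForm α x₀ z :=
      rfl
    have h0 : F q ((natChart x₀).symm z) ≠ 0 := ((hF q hq).pos _ hz.2).ne'
    have h1 : κ q ((natChart x₀).symm z) ≠ 0 := hκ0 q hq _ hz.2
    rw [e1, hα q hq x₀ z hz, hric q hq _ hz.2, dJFun, dJFun, (hL.hasFDerivAt hS hz).fderiv]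
    refine ContinuousLinearMap.ext fun u => ?_
    simp [locFun]
    field_simp
  have hθe : ∀ q ∈ slit, ∀ x₀ : M, ∀ z ∈ chartDom x₀ (A q), locForm (S.divRicci α) x₀
      =ᶠ[nhds z] dJFun (fun w => Real.log (locFun (F q) x₀ w)) := fun q hq x₀ z hz => by
    filter_upwards [(isOpen_chartDom x₀ (hA q hq).isOpen).mem_nhds hz] with w hw
    exact hθ q hq x₀ w hw
  have hloc : ∀ x₀ : M, ∀ z ∈ chartDom x₀ (slit (n := n)), ∃ q ∈ slit, z ∈ chartDom x₀ (A q) :=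
    fun x₀ z hz => ⟨_, hz.2, hz.1, hpA _ hz.2⟩
  refine ⟨α, ⟨?_, ?_, ?_⟩, ?_, ?_, ?_⟩
  · intro x₀ z hz
    obtain ⟨q, hq, hzq⟩ := hloc x₀ z hz
    have hop := isOpen_chartDom x₀ (hA q hq).isOpen
    have h1 := (contDiffOn_locFun (hA q hq).isOpen (hF q hq).smooth x₀).contDiffAt
      (hop.mem_nhds hzq)
    have h2 := (contDiffOn_locFun (hA q hq).isOpen (hκ q hq) x₀).contDiffAt (hop.mem_nhds hzq)
    refine ContDiffAt.contDiffWithinAt (ContDiffAt.congr_of_eventuallyEq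
      (f := fun w => (locFun (κ q) x₀ w * locFun (F q) x₀ w) • dJFun (locFun (F q) x₀) w) ?_ ?_)
    · exact (h2.mul h1).smul ((h1.fderiv_right (m := ∞) (by simp)).clm_comp contDiffAt_const)
    · filter_upwards [hop.mem_nhds hzq] with w hw
      exact hα q hq x₀ w hw
  · intro x₀ z hz b
    rw [hα0 x₀ z hz _ rfl, dJFun, smul_apply, ContinuousLinearMap.comp_apply, tangentStr_apply,
      ← Prod.zero_eq_mk, map_zero, smul_zero]
  · intro x₀ z hz
    obtain ⟨q, hq, hzq⟩ := hloc x₀ z hz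
    rw [hΦ' q hq x₀ z hzq, hα q hq x₀ z hzq]
  · intro x₀ z hz a b
    obtain ⟨q, hq, hzq⟩ := hloc x₀ z hz
    have hL := (hF q hq).isLocalFinsler (hA q hq).isOpen (hG q hq) x₀
    have hS := S.isLocalSpray x₀ (hA q hq).isOpen (hA q hq).subset
    have e := hθe q hq x₀ z hzq
    have e2 : (fun w => (locForm (S.divRicci α) x₀ w).comp (tangentStr n)) =ᶠ[nhds z]
        fun w => (dJFun (fun w => Real.log (locFun (F q) x₀ w)) w).comp (tangentStr n) :=
      e.mono fun w hw => by simp only [hw]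
    have e3 := (hL.isSemibasicOn hS).dJForm_eq hS.isOpen hzq a b
    rw [hL.fderiv_vertical_symm hS hzq, sub_self] at e3
    rw [← e3]
    simp only [dJForm, extD, e.fderiv_eq, e2.fderiv_eq]
  · intro x₀ X Y hX hY z hz
    obtain ⟨q, hq, hzq⟩ := hloc x₀ z hz
    have hL := (hF q hq).isLocalFinsler (hA q hq).isOpen (hG q hq) x₀
    have hS := S.isLocalSpray x₀ (hA q hq).isOpen (hA q hq).subset
    have e := hθe q hq x₀ z hzq
    have e2 : (fun w => locForm (S.divRicci α) x₀ w (Y w)) =ᶠ[nhds z]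
        fun w => dJFun (fun w => Real.log (locFun (F q) x₀ w)) w (Y w) :=
      e.mono fun w hw => by simp only [hw]
    have hop := isOpen_chartDom x₀ (isOpen_slit (n := n) (M := M))
    have e3 := (hL.isSemibasicOn hS).berwaldForm_eq hS hzq
      ((hX.contDiffAt (hop.mem_nhds hz)).differentiableAt (by simp))
      ((hY.contDiffAt (hop.mem_nhds hz)).differentiableAt (by simp))
    rw [hL.horDeriv_eq_zero hS hzq] at e3
    rw [← e3, berwaldForm, berwaldForm, e2.fderiv_eq, e.eq_of_nhds]
  · intro x₀ z hz a hab
    obtain ⟨q, hq, hzq⟩ := hloc x₀ z hz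
    have hL := (hF q hq).isLocalFinsler (hA q hq).isOpen (hG q hq) x₀
    have hS := S.isLocalSpray x₀ (hA q hq).isOpen (hA q hq).subset
    have e := hθe q hq x₀ z hzq
    refine (hF q hq).symplectic x₀ z hzq a fun b => ?_
    have h1 := hab b
    simp only [extD, e.fderiv_eq, e.eq_of_nhds] at h1
    rw [← hL.fderiv_log_eq hS hzq] at h1
    rw [ddJSq, hL.extD_sq hS hzq, extD, h1, mul_zero]

end

/-! ### Closed 1-forms with a primitive -/

section

section Poincare

variable {E : Type*} [NormedAddCommGroup E] [NormedSpace ℝ E] {η : E → E →L[ℝ] ℝ} {s t : Set E}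

/-- The Poincaré lemma for star-shaped open sets. The primitive is the integral along segments from
the centre; each of these segments has a convex neighbourhood in `s`. -/
theorem exists_primitive_of_starConvex {a : E} (hs : StarConvex ℝ a s) (hso : IsOpen s)
    (hη : DifferentiableOn ℝ η s)
    (hdη : ∀ z ∈ s, ∀ u w, fderiv ℝ η z u w = fderiv ℝ η z w u) :
    ∃ f : E → ℝ, ∀ z ∈ s, HasFDerivAt f (η z) z := by
  refine ⟨fun z => curveIntegral η (.segment a z), fun z hz => ?_⟩
  have hcomp : IsCompact (segment ℝ a z) := by
    rw [segment_eq_image_lineMap]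
    exact isCompact_Icc.image AffineMap.lineMap_continuous
  obtain ⟨δ, hδ, hsub⟩ := hcomp.exists_thickening_subset_open hso (hs.segment_subset hz)
  have hself := Metric.self_subset_thickening hδ (segment ℝ a z)
  have hconv : Convex ℝ (Metric.thickening δ (segment ℝ a z)) := (convex_segment a z).thickening δ
  have hop : IsOpen (Metric.thickening δ (segment ℝ a z)) := Metric.isOpen_thickening
  exact (hconv.hasFDerivWithinAt_curveIntegral_segment_of_hasFDerivWithinAt_symmetric
    (fun x hx => ((hη x (hsub hx)).differentiableAt
      (hso.mem_nhds (hsub hx))).hasFDerivAt.hasFDerivWithinAt)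
    (fun x hx u _ w _ => hdη x (hsub hx) u w)
    (hself (left_mem_segment ℝ a z)) (hself (right_mem_segment ℝ a z))).hasFDerivAt
    (hop.mem_nhds (hself (right_mem_segment ℝ a z)))

/-- Primitives on two open sets with connected intersection differ by a constant there, so
that they glue. -/
theorem exists_primitive_union (hs : IsOpen s) (ht : IsOpen t) (hst : IsPreconnected (s ∩ t))
    {f g : E → ℝ} (hf : ∀ z ∈ s, HasFDerivAt f (η z) z) (hg : ∀ z ∈ t, HasFDerivAt g (η z) z) :
    ∃ k : E → ℝ, ∀ z ∈ s ∪ t, HasFDerivAt k (η z) z := by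
  classical
  have hd : ∀ z ∈ s ∩ t, HasFDerivAt (fun z => f z - g z) 0 z := fun z hz => by
    simpa using! (hf z hz.1).sub (hg z hz.2)
  obtain ⟨c, hc⟩ := (hs.inter ht).exists_is_const_of_fderiv_eq_zero hst
    (fun z hz => (hd z hz).differentiableAt.differentiableWithinAt)
    (fun z hz => (hd z hz).fderiv)
  refine ⟨fun z => if z ∈ s then f z else g z + c, fun z hz => ?_⟩
  by_cases h : z ∈ s
  · refine (hf z h).congr_of_eventuallyEq ?_
    filter_upwards [hs.mem_nhds h] with w hw
    simp [hw]
  · have hzt := hz.resolve_left h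
    refine ((hg z hzt).add_const c).congr_of_eventuallyEq ?_
    filter_upwards [ht.mem_nhds hzt] with w hw
    by_cases hws : w ∈ s
    · have := hc w ⟨hws, hw⟩
      simp [hws]
      linarith
    · simp [hws]

/-- The complement of the closed ray from `0` in the direction `v`. -/
def rayCompl (v : E) : Set E := {y | ∀ t : ℝ, 0 ≤ t → y ≠ t • v}

theorem isOpen_rayCompl {v : E} (hv : v ≠ 0) : IsOpen (rayCompl v) := by
  have h1 : IsClosed ((fun t : ℝ => t • v) '' Set.Ici 0) :=
    (isClosedEmbedding_smul_left hv).isClosedMap _ isClosed_Ici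
  convert h1.isOpen_compl using 1
  ext y
  simp only [rayCompl, Set.mem_compl_iff, Set.mem_image, Set.mem_Ici, not_exists, not_and]
  exact ⟨fun h t ht h' => h t ht h'.symm, fun h t ht h' => h t ht h'.symm⟩

theorem starConvex_rayCompl (v : E) (hv : v ≠ 0) : StarConvex ℝ (-v) (rayCompl v) := by
  intro y hy a b ha hb hab t ht h
  have h1 : b • y = (t + a) • v := by
    rw [add_smul, ← h, smul_neg]; abel
  rcases hb.eq_or_lt with rfl | hb
  · rw [zero_smul] at h1
    have := (smul_eq_zero.1 h1.symm).resolve_right hv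
    linarith
  · refine hy (b⁻¹ * (t + a)) (by positivity) ?_
    rw [mul_smul, ← h1, inv_smul_smul₀ hb.ne']

theorem rayCompl_union {v : E} (hv : v ≠ 0) : rayCompl v ∪ rayCompl (-v) = {0}ᶜ := by
  ext y
  constructor
  · rintro (h | h) h0
    · exact h 0 le_rfl (by simpa using h0)
    · exact h 0 le_rfl (by simpa using h0)
  · intro h0
    by_contra h
    simp only [Set.mem_union, not_or, rayCompl, Set.mem_ofPred_eq, not_forall, not_not] at h
    obtain ⟨⟨t, ht, e1⟩, ⟨s, hs, e2⟩⟩ := h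
    have h1 : (t + s) • v = 0 := by rw [add_smul, ← e1, e2]; simp
    have h2 := (smul_eq_zero.1 h1).resolve_right hv
    have h3 : t = 0 := by linarith
    exact h0 (by rw [e1, h3]; simp)

theorem rayCompl_inter (v : E) :
    rayCompl v ∩ rayCompl (-v) = ((Submodule.span ℝ {v} : Submodule ℝ E) : Set E)ᶜ := by
  ext y
  simp only [Set.mem_inter_iff, rayCompl, Set.mem_ofPred_eq, Set.mem_compl_iff, SetLike.mem_coe,
    Submodule.mem_span_singleton, not_exists]
  constructor
  · rintro ⟨h1, h2⟩ c rfl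
    rcases le_total 0 c with hc | hc
    · exact h1 c hc rfl
    · exact h2 (-c) (by linarith) (by simp)
  · refine fun h => ⟨fun t _ e => h t e.symm, fun t _ e => h (-t) ?_⟩
    rw [e]; simp

end Poincare

/-- For `n ≥ 3` and `U` convex, closed 1-forms on `U × (ℝⁿ \ {0})` are exact: the set is covered by
two star-shaped sets, which meet in the complement of a line in the second factor. -/
theorem exists_primitive_prod_compl_zero {n : ℕ} (hn : 3 ≤ n) {η : Tot n → Tot n →L[ℝ] ℝ}
    {U : Set (Base n)} (hU : Convex ℝ U) (hUo : IsOpen U)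
    (hη : DifferentiableOn ℝ η (U ×ˢ {0}ᶜ))
    (hdη : ∀ z ∈ U ×ˢ ({0}ᶜ : Set (Base n)), ∀ u w, fderiv ℝ η z u w = fderiv ℝ η z w u) :
    ∃ f : Tot n → ℝ, ∀ z ∈ U ×ˢ ({0}ᶜ : Set (Base n)), HasFDerivAt f (η z) z := by
  rcases U.eq_empty_or_nonempty with rfl | ⟨x, hx⟩
  · simp
  have hfr : Module.finrank ℝ (Base n) = n := by simp
  have : Nontrivial (Base n) := Module.nontrivial_of_finrank_pos (R := ℝ) (by omega)
  obtain ⟨v, hv⟩ := exists_ne (0 : Base n)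
  have hsub : ∀ v : Base n, v ≠ 0 → ∃ f : Tot n → ℝ, ∀ z ∈ U ×ˢ rayCompl v,
      HasFDerivAt f (η z) z := fun v hv => by
    have h1 : U ×ˢ rayCompl v ⊆ U ×ˢ ({0}ᶜ : Set (Base n)) := by
      refine Set.prod_mono_right ?_
      rw [← rayCompl_union hv]
      exact Set.subset_union_left
    exact exists_primitive_of_starConvex (a := (x, -v))
      ((hU.starConvex hx).prod (starConvex_rayCompl v hv)) (hUo.prod (isOpen_rayCompl hv))
      (hη.mono h1) fun z hz => hdη z (h1 hz)
  obtain ⟨f, hf⟩ := hsub v hv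
  obtain ⟨g, hg⟩ := hsub (-v) (neg_ne_zero.2 hv)
  have hcodim : 1 < Module.rank ℝ (Base n ⧸ Submodule.span ℝ {v}) := by
    rw [← Module.finrank_eq_rank]
    have h1 := Submodule.finrank_quotient_add_finrank (Submodule.span ℝ {v} : Submodule ℝ (Base n))
    rw [finrank_span_singleton hv, hfr] at h1
    have h2 : 1 < Module.finrank ℝ (Base n ⧸ Submodule.span ℝ {v}) := by omega
    exact_mod_cast h2
  have hconn := (hU.isPreconnected).prod (isConnected_compl_of_one_lt_codim hcodim).isPreconnected
  rw [← rayCompl_inter v, Set.prod_inter] at hconn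
  obtain ⟨k, hk⟩ := exists_primitive_union (hUo.prod (isOpen_rayCompl hv))
    (hUo.prod (isOpen_rayCompl (neg_ne_zero.2 hv))) hconn hf hg
  rw [← Set.prod_union, rayCompl_union hv] at hk
  exact ⟨k, hk⟩

end

/-! ### The closed form attached to the four conditions -/

section

variable {n : ℕ} {M : Type*} [TopologicalSpace M] [ChartedSpace (Base n) M]
  [IsManifold 𝓘(ℝ, Base n) ∞ M] {x₀ : M} {z : Tot n} {A : Set (TM n M)}

theorem extD_pullback {θ η : Tot n → Tot n →L[ℝ] ℝ} {φ : Tot n → Tot n}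
    (hφ : ContDiffAt ℝ ∞ φ z) (hη : DifferentiableAt ℝ η (φ z))
    (h : θ =ᶠ[nhds z] fun w => (η (φ w)).comp (fderiv ℝ φ w)) (u w : Tot n) :
    extD θ z u w = extD η (φ z) (fderiv ℝ φ z u) (fderiv ℝ φ z w) := by
  have h1 : HasFDerivAt φ (fderiv ℝ φ z) z := (hφ.differentiableAt (by simp)).hasFDerivAt
  have h2 : HasFDerivAt (fderiv ℝ φ) (fderiv ℝ (fderiv ℝ φ) z) z :=
    ((hφ.fderiv_right (m := ∞) (by simp)).differentiableAt (by simp)).hasFDerivAt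
  have h3 : HasFDerivAt (fun w => (η (φ w)).comp (fderiv ℝ φ w)) _ z :=
    (hη.hasFDerivAt.comp z h1).clm_comp h2
  rw [extD, h.fderiv_eq, h3.fderiv, extD]
  simp [fderiv_fderiv_symm hφ u w]

namespace Spray

variable {S : Spray n M} {α : OneForm n M}

/-- The 1-form `θ ∘ 𝔽` on `TM`, computed at each point in the natural chart at its base point. -/
def potentialForm (S : Spray n M) (θ : OneForm n M) : OneForm n M :=
  ofChartForms fun x z => (locForm θ x z).comp (almostCpx (S.loc x) z)

theorem IsotropicWith.ricci_eq (hα : S.IsotropicWith α) (hz : z ∈ chartDom x₀ (slit (n := n))) :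
    locFun S.ricci x₀ z = locForm α x₀ z (z.2, 0) := by
  have hS := S.isLocalSpray x₀ (isOpen_slit (n := n) (M := M)) subset_rfl
  have h1 := hS.jacobiEnd_self hz
  rw [hα.jacobi x₀ z hz] at h1
  have h2 := congrArg Prod.snd h1
  simp [tangentStr_apply, liouville, ← sub_smul] at h2
  have := h2.resolve_right (snd_ne_zero_of_mem_chartDom hz)
  linarith

theorem IsotropicWith.contDiffOn_ricci (hα : S.IsotropicWith α) (x₀ : M) :
    ContDiffOn ℝ ∞ (locFun S.ricci x₀) (chartDom x₀ (slit (n := n))) := by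
  refine ContDiffOn.congr (f := fun z => locForm α x₀ z (z.2, 0)) ?_ fun z hz => hα.ricci_eq hz
  exact (hα.smooth x₀).clm_apply (contDiffOn_snd.prodMk contDiffOn_const)

theorem locForm_divRicci (S : Spray n M) (α : OneForm n M) (x₀ : M) (z : Tot n) :
    locForm (S.divRicci α) x₀ z = (locFun S.ricci x₀ z)⁻¹ • locForm α x₀ z := rfl

/-- The first three of the four conditions on a spray, with the isotropy form `α`, for a Ricci
scalar without zeros. -/
structure ParallelIsotropic (S : Spray n M) (α : OneForm n M) : Prop where
  ricci_ne_zero : ∀ p ∈ slit (n := n) (M := M), S.ricci p ≠ 0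
  isotropic : S.IsotropicWith α
  dJClosed : DJClosed (S.divRicci α)
  horParallel : S.HorParallel (S.divRicci α)

namespace ParallelIsotropic

theorem isSemibasicOn (h : ParallelIsotropic S α) (x₀ : M) :
    IsSemibasicOn (chartDom x₀ (slit (n := n))) (locForm (S.divRicci α) x₀) where
  smooth := ((h.isotropic.contDiffOn_ricci x₀).inv fun _ hz => h.ricci_ne_zero _ hz.2).smul
    (h.isotropic.smooth x₀)
  vertical := fun z hz b => by
    rw [locForm_divRicci, smul_apply, h.isotropic.semibasic x₀ z hz, smul_zero]

/-- `θ(S) = 1` for `θ = α / ρ`. -/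
theorem apply_liouville (h : ParallelIsotropic S α) (hz : z ∈ chartDom x₀ (slit (n := n))) :
    locForm (S.divRicci α) x₀ z (z.2, 0) = 1 := by
  rw [locForm_divRicci, smul_apply, ← h.isotropic.ricci_eq hz]
  exact inv_mul_cancel₀ (h.ricci_ne_zero _ hz.2)

theorem fderiv_vertical_symm (h : ParallelIsotropic S α) (hz : z ∈ chartDom x₀ (slit (n := n)))
    (a b : Base n) : fderiv ℝ (locForm (S.divRicci α) x₀) z (0, a) (b, 0)
      = fderiv ℝ (locForm (S.divRicci α) x₀) z (0, b) (a, 0) := by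
  have h1 := h.dJClosed x₀ z hz (a, 0) (b, 0)
  rw [(h.isSemibasicOn x₀).dJForm_eq (isOpen_chartDom x₀ isOpen_slit) hz] at h1
  exact sub_eq_zero.1 h1

theorem horDeriv_eq_zero (h : ParallelIsotropic S α) (hz : z ∈ chartDom x₀ (slit (n := n)))
    (a b : Base n) : horDeriv (S.loc x₀) (locForm (S.divRicci α) x₀) z a b = 0 := by
  rw [← h.horParallel x₀ (fun _ => (a, 0)) (fun _ => (b, 0)) contDiffOn_const contDiffOn_const z hz,
    (h.isSemibasicOn x₀).berwaldForm_eq (S.isLocalSpray x₀ isOpen_slit subset_rfl) hz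
      (differentiableAt_const _) (differentiableAt_const _)]

theorem extD_potential (h : ParallelIsotropic S α) (hz : z ∈ chartDom x₀ (slit (n := n)))
    (u w : Tot n) :
    extD (fun v => (locForm (S.divRicci α) x₀ v).comp (almostCpx (S.loc x₀) v)) z u w = 0 := by
  have hS := S.isLocalSpray x₀ (isOpen_slit (n := n) (M := M)) subset_rfl
  refine (h.isSemibasicOn x₀).extD_comp_almostCpx hS hz (h.fderiv_vertical_symm hz)
    (h.horDeriv_eq_zero hz) ?_ u w
  refine (h.isSemibasicOn x₀).apply_curvature hS hz (ρ := locFun S.ricci x₀)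
    (((h.isotropic.contDiffOn_ricci x₀).contDiffAt (hS.isOpen.mem_nhds hz)).differentiableAt
      (by simp)) (h.apply_liouville hz) (fun w hw a => ?_) (h.fderiv_vertical_symm hz)
  have hne : locFun S.ricci x₀ w ≠ 0 := h.ricci_ne_zero _ hw.2
  rw [h.isotropic.jacobi x₀ w hw, locForm_divRicci]
  simp [tangentStr_apply, liouville, hne]

/-- `θ ∘ 𝔽 = i_S dθ` for `θ = α / ρ`. -/
theorem comp_almostCpx_eq (h : ParallelIsotropic S α) (hz : z ∈ chartDom x₀ (slit (n := n)))
    (u : Tot n) : ((locForm (S.divRicci α) x₀ z).comp (almostCpx (S.loc x₀) z)) u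
      = extD (locForm (S.divRicci α) x₀) z (S.loc x₀ z) u :=
  ((h.isSemibasicOn x₀).extD_spray (S.isLocalSpray x₀ isOpen_slit subset_rfl) hz
    (fun _ hw => h.apply_liouville hw) (h.horDeriv_eq_zero hz) u).symm

theorem comp_almostCpx_chartTrans (h : ParallelIsotropic S α) {x₁ : M}
    (hz : z ∈ chartDom x₀ (slit (n := n)))
    (hz1 : (natChart x₀).symm z ∈ (natChart (n := n) x₁).source) :
    (locForm (S.divRicci α) x₀ z).comp (almostCpx (S.loc x₀) z)
      = ((locForm (S.divRicci α) x₁ (chartTrans x₀ x₁ z)).comp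
          (almostCpx (S.loc x₁) (chartTrans x₀ x₁ z))).comp (fderiv ℝ (chartTrans x₀ x₁) z) := by
  have hz' := chartTrans_mem_chartDom hz hz1
  refine ContinuousLinearMap.ext fun u => ?_
  rw [h.comp_almostCpx_eq hz, ContinuousLinearMap.comp_apply, h.comp_almostCpx_eq hz',
    extD_pullback (contDiffAt_chartTrans hz.1 hz1)
      ((h.isSemibasicOn x₁).differentiableAt (isOpen_chartDom x₁ isOpen_slit) hz')]
  · rw [Spray.loc, Spray.loc, locVec_chartTrans S.field hz.1 hz1]
  · filter_upwards [eventually_symm_mem hz.1 (isOpen_natChart_source x₁) hz1] with w hw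
    exact locForm_chartTrans _ hw.1 hw.2

theorem locForm_potentialForm (h : ParallelIsotropic S α) (hz : z ∈ chartDom x₀ (slit (n := n))) :
    locForm (S.potentialForm (S.divRicci α)) x₀ z
      = (locForm (S.divRicci α) x₀ z).comp (almostCpx (S.loc x₀) z) := by
  rw [potentialForm, locForm_ofChartForms _ hz.1,
    h.comp_almostCpx_chartTrans hz (mem_natChart_source_self _)]

theorem contDiffOn_potential (h : ParallelIsotropic S α) (x₀ : M) :
    ContDiffOn ℝ ∞ (fun v => (locForm (S.divRicci α) x₀ v).comp (almostCpx (S.loc x₀) v))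
      (chartDom x₀ (slit (n := n))) := by
  have hS := S.isLocalSpray x₀ (isOpen_slit (n := n) (M := M)) subset_rfl
  have hC : ContDiffOn ℝ ∞ (connCoeff (S.loc x₀)) (chartDom x₀ (slit (n := n))) :=
    fun w hw => (hS.contDiffAt_connCoeff hw).contDiffWithinAt
  refine ContDiffOn.congr (f := fun v => (locForm (S.divRicci α) x₀ v).comp
    ((ContinuousLinearMap.inl ℝ (Base n) (Base n)).comp
      (ContinuousLinearMap.snd ℝ (Base n) (Base n)
        - (connCoeff (S.loc x₀) v).comp (ContinuousLinearMap.fst ℝ (Base n) (Base n))))) ?_ ?_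
  · exact (h.isSemibasicOn x₀).smooth.clm_comp (contDiffOn_const.clm_comp
      (contDiffOn_const.sub (hC.clm_comp contDiffOn_const)))
  · intro v hv
    refine ContinuousLinearMap.ext fun w => ?_
    simp only [ContinuousLinearMap.comp_apply, hS.almostCpx_apply hv]
    exact (h.isSemibasicOn x₀).apply_eq hv _ _

end ParallelIsotropic

end Spray

end

/-! ### The Finsler function of a potential -/

section

variable {n : ℕ} {M : Type*} [TopologicalSpace M] [ChartedSpace (Base n) M]
  [IsManifold 𝓘(ℝ, Base n) ∞ M] {x₀ : M} {z : Tot n} {A : Set (TM n M)}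

/-- A positively 1-homogeneous function that is continuous off the zero section and zero there is
continuous: locally it is bounded on the unit sphere, hence by a multiple of `|y|`. -/
theorem continuousOn_of_homogeneous {F : TM n M → ℝ} {U : Set M} (hU : IsOpen U)
    (hF : ContinuousOn F (slitOver U)) (h0 : ∀ x ∈ U, F ⟨x, 0⟩ = 0)
    (hh : ∀ p ∈ slitOver U, ∀ c : ℝ, 0 < c → F (scale c p) = c * F p) :
    ContinuousOn F {p : TM n M | p.1 ∈ U} := by
  intro p hp
  refine ContinuousAt.continuousWithinAt ?_
  by_cases hp0 : p.2 = 0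
  swap
  · exact hF.continuousAt ((isOpen_slitOver hU).mem_nhds ⟨hp, hp0⟩)
  set x₀ := p.1 with hx₀
  have hps : p ∈ (natChart (n := n) x₀).source := mem_natChart_source_self p
  have hz0 : (natChart x₀ p).2 = 0 := (natChart_snd_eq_zero hps).2 hp0
  have hFp : F p = 0 := by
    rw [← h0 x₀ hp, hx₀, ← hp0]
  have hzt := PartialEquiv.map_source _ hps
  obtain ⟨r, hr, hball⟩ : ∃ r > 0, ∀ w : Tot n, w.1 ∈ Metric.closedBall (natChart x₀ p).1 r →
      w ∈ (natChart (n := n) x₀).target ∧ ((natChart (n := n) x₀).symm w).1 ∈ U := by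
    have hV : IsOpen {q : TM n M | q.1 ∈ U} :=
      hU.preimage (FiberBundle.continuous_proj (Base n) _)
    have h1 := eventually_symm_mem hzt hV (by rwa [PartialEquiv.left_inv _ hps])
    have hc : Filter.Tendsto (fun a : Base n => ((a, (natChart x₀ p).2) : Tot n))
        (nhds (natChart x₀ p).1) (nhds (natChart x₀ p)) :=
      (Continuous.prodMk_left _).tendsto _
    obtain ⟨r, hr, h2⟩ := Metric.nhds_basis_closedBall.eventually_iff.1 (hc.eventually h1)
    exact ⟨r, hr, fun w hw => ⟨mem_natChart_target.2 (mem_natChart_target.1 (h2 hw).1),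
      (h2 hw).2⟩⟩
  have hK : IsCompact (Metric.closedBall (natChart x₀ p).1 r ×ˢ
      Metric.sphere (0 : Base n) 1) :=
    (isCompact_closedBall _ _).prod (isCompact_sphere _ _)
  have hslit : ∀ w : Tot n, w.1 ∈ Metric.closedBall (natChart x₀ p).1 r → w.2 ≠ 0 →
      (natChart x₀).symm w ∈ slitOver U := fun w hw hw2 =>
    ⟨(hball w hw).2, (natChart_symm_mem_slit (hball w hw).1).2 hw2⟩
  have hcont : ContinuousOn (locFun F x₀) (Metric.closedBall (natChart x₀ p).1 r ×ˢ
      Metric.sphere (0 : Base n) 1) := fun w hw => by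
    have hw2 : w.2 ≠ 0 := ne_zero_of_mem_unit_sphere ⟨w.2, hw.2⟩
    exact ((hF.continuousAt ((isOpen_slitOver hU).mem_nhds (hslit w hw.1 hw2))).comp
      (contMDiffAt_natChart_symm (hball w hw.1).1).continuousAt).continuousWithinAt
  obtain ⟨C, hC⟩ := hK.exists_bound_of_continuousOn hcont
  have hbound : ∀ w : Tot n, w.1 ∈ Metric.closedBall (natChart x₀ p).1 r →
      ‖locFun F x₀ w‖ ≤ C * ‖w.2‖ := fun w hw => by
    by_cases hw2 : w.2 = 0
    · have h1 : (natChart x₀).symm w = ⟨((natChart x₀).symm w).1, 0⟩ := by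
        have h2 : w = (w.1, (0 : ℝ) • w.2) := by simp [← hw2]
        have h3 := natChart_symm_smul x₀ 0 w
        rw [← h2] at h3
        rw [h3]
        exact congrArg (fun v => (⟨_, v⟩ : TM n M)) (zero_smul ℝ ((natChart x₀).symm w).2)
      rw [locFun, h1, h0 _ (hball w hw).2, hw2]
      simp
    · have hn0 : 0 < ‖w.2‖ := norm_pos_iff.2 hw2
      have h1 : w = (w.1, ‖w.2‖ • (‖w.2‖⁻¹ • w.2)) := by
        rw [smul_inv_smul₀ hn0.ne']
      have h2 : ‖w.2‖⁻¹ • w.2 ≠ 0 := smul_ne_zero (inv_ne_zero hn0.ne') hw2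
      have h3 : locFun F x₀ w = ‖w.2‖ * locFun F x₀ (w.1, ‖w.2‖⁻¹ • w.2) := by
        conv_lhs => rw [h1, locFun]
        rw [natChart_symm_smul x₀ ‖w.2‖ (w.1, ‖w.2‖⁻¹ • w.2),
          hh _ (hslit (w.1, ‖w.2‖⁻¹ • w.2) hw h2) _ hn0]
        rfl
      have h4 := hC (w.1, ‖w.2‖⁻¹ • w.2) ⟨hw, by
        rw [mem_sphere_zero_iff_norm, norm_smul, norm_inv, norm_norm, inv_mul_cancel₀ hn0.ne']⟩
      rw [h3, norm_mul, norm_norm, mul_comm]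
      gcongr
  have hchart := (contMDiffAt_natChart hps).continuousAt
  rw [ContinuousAt, hFp]
  refine squeeze_zero_norm' (a := fun q => C * ‖(natChart x₀ q).2‖) ?_ ?_
  · filter_upwards [(isOpen_natChart_source x₀).mem_nhds hps,
      hchart.fst.preimage_mem_nhds (Metric.closedBall_mem_nhds _ hr)] with q hq hq2
    have := hbound _ hq2
    rwa [locFun, PartialEquiv.left_inv _ hq] at this
  · have h1 := (hchart.snd.norm).const_mul C
    rw [ContinuousAt, hz0, norm_zero, mul_zero] at h1
    exact h1

namespace Spray

variable {S : Spray n M} {α : OneForm n M}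

/-- `f` is a primitive of `θ ∘ 𝔽` on `A`. -/
def HasPotential (S : Spray n M) (θ : OneForm n M) (A : Set (TM n M)) (f : TM n M → ℝ) : Prop :=
  ∀ x₀ : M, ∀ z ∈ chartDom x₀ A,
    HasFDerivAt (locFun f x₀) ((locForm θ x₀ z).comp (almostCpx (S.loc x₀) z)) z

namespace ParallelIsotropic

variable {f : TM n M → ℝ}

theorem contMDiffOn_potential (h : ParallelIsotropic S α) (hA : IsOpen A) (hAs : A ⊆ slit)
    (hf : S.HasPotential (S.divRicci α) A f) :
    ContMDiffOn (𝓘(ℝ, Base n).tangent) 𝓘(ℝ, ℝ) ∞ f A := by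
  intro p hp
  have hps := mem_natChart_source_self p
  refine (contMDiffAt_of_locFun hps ?_).contMDiffWithinAt
  have hop := isOpen_chartDom p.1 hA
  have h1 : ContDiffOn ℝ ∞ (locFun f p.1) (chartDom p.1 A) := by
    rw [contDiffOn_infty_iff_fderiv_of_isOpen hop]
    refine ⟨fun z hz => (hf p.1 z hz).differentiableAt.differentiableWithinAt, ?_⟩
    exact ((h.contDiffOn_potential p.1).mono (chartDom_mono hAs p.1)).congr
      fun z hz => (hf p.1 z hz).fderiv
  exact h1.contDiffAt (hop.mem_nhds (natChart_mem_chartDom hp hps))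

/-- A primitive of `θ ∘ 𝔽` grows by `log c` under `(x, y) ↦ (x, c y)`, since `(θ ∘ 𝔽)(ℂ) = 1`. -/
theorem potential_scale (h : ParallelIsotropic S α) (hA : IsConicRegion A)
    (hf : S.HasPotential (S.divRicci α) A f) {p : TM n M} (hp : p ∈ A) {c : ℝ} (hc : 0 < c) :
    f (scale c p) = f p + Real.log c := by
  have hps := mem_natChart_source_self p
  set x₀ := p.1
  set z := natChart x₀ p with hz
  have hzA : z ∈ chartDom x₀ A := natChart_mem_chartDom hp hps
  have hmem : ∀ c : ℝ, 0 < c → ((z.1, c • z.2) : Tot n) ∈ chartDom x₀ A := fun c hc =>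
    ⟨mem_natChart_target.2 (mem_natChart_target.1 hzA.1), by
      rw [natChart_symm_smul]; exact hA.scale_mem _ hzA.2 c hc⟩
  have hd : ∀ c ∈ Set.Ioi (0 : ℝ), HasDerivAt
      (fun c : ℝ => locFun f x₀ (z.1, c • z.2) - Real.log c) 0 c := fun c hc => by
    have hc : 0 < c := hc
    have h1 : HasDerivAt (fun c : ℝ => ((z.1, c • z.2) : Tot n)) (0, z.2) c := by
      refine (hasDerivAt_const c z.1).prodMk ?_
      simpa using (hasDerivAt_id c).smul_const z.2
    have hm := chartDom_mono hA.subset x₀ (hmem c hc)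
    have h2 := (hf x₀ _ (hmem c hc)).comp_hasDerivAt c h1
    have h3 : ((locForm (S.divRicci α) x₀ (z.1, c • z.2)).comp
        (almostCpx (S.loc x₀) (z.1, c • z.2))) (0, z.2) = c⁻¹ := by
      have h4 := h.apply_liouville hm
      rw [ContinuousLinearMap.comp_apply,
        (S.isLocalSpray x₀ isOpen_slit subset_rfl).almostCpx_apply hm,
        (h.isSemibasicOn x₀).apply_eq hm]
      simp only [map_zero, sub_zero]
      have h5 : (((c • z.2 : Base n), 0) : Tot n) = c • (z.2, 0) := by simp
      rw [h5, map_smul, smul_eq_mul] at h4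
      exact eq_inv_of_mul_eq_one_right h4
    rw [h3] at h2
    have h6 := h2.sub (Real.hasDerivAt_log hc.ne')
    rw [sub_self] at h6
    exact h6
  have h1 := isOpen_Ioi.is_const_of_deriv_eq_zero (isPreconnected_Ioi (a := (0 : ℝ)))
    (fun c hc => (hd c hc).differentiableAt.differentiableWithinAt)
    (fun c hc => (hd c hc).deriv) (Set.mem_Ioi.2 hc) (Set.mem_Ioi.2 one_pos)
  simp only [Real.log_one, locFun, natChart_symm_smul, one_smul, Prod.mk.eta, sub_zero, hz,
    PartialEquiv.left_inv _ hps] at h1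
  linarith

section

variable {F : TM n M → ℝ}

theorem hasFDerivAt_exp (hA : IsOpen A) (hf : S.HasPotential (S.divRicci α) A f)
    (hF : ∀ p ∈ A, F p = Real.exp (f p)) (hz : z ∈ chartDom x₀ A) :
    HasFDerivAt (locFun F x₀) (locFun F x₀ z •
      ((locForm (S.divRicci α) x₀ z).comp (almostCpx (S.loc x₀) z))) z := by
  have h1 : locFun F x₀ =ᶠ[nhds z] fun w => Real.exp (locFun f x₀ w) := by
    filter_upwards [(isOpen_chartDom x₀ hA).mem_nhds hz] with w hw
    exact hF _ hw.2
  rw [h1.eq_of_nhds]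
  exact (hf x₀ z hz).exp.congr_of_eventuallyEq h1

theorem potential_comp_tangentStr (h : ParallelIsotropic S α)
    (hz : z ∈ chartDom x₀ (slit (n := n))) :
    ((locForm (S.divRicci α) x₀ z).comp (almostCpx (S.loc x₀) z)).comp (tangentStr n)
      = locForm (S.divRicci α) x₀ z := by
  refine ContinuousLinearMap.ext fun u => ?_
  have h1 := (h.isSemibasicOn x₀).apply_eq hz u.1 u.2
  rw [Prod.mk.eta] at h1
  rw [ContinuousLinearMap.comp_apply, ContinuousLinearMap.comp_apply, tangentStr_apply,
    (S.isLocalSpray x₀ isOpen_slit subset_rfl).almostCpx_apply hz,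
    (h.isSemibasicOn x₀).apply_eq hz, h1]
  simp

theorem ddJSq_eq (h : ParallelIsotropic S α) (hA : IsOpen A) (hAs : A ⊆ slit)
    (hf : S.HasPotential (S.divRicci α) A f)
    (hF : ∀ p ∈ A, F p = Real.exp (f p)) (hz : z ∈ chartDom x₀ A) (a b : Tot n) :
    ddJSq F x₀ z a b = 2 * locFun F x₀ z ^ 2 * (extD (locForm (S.divRicci α) x₀) z a b
      + 2 * wedge ((locForm (S.divRicci α) x₀ z).comp (almostCpx (S.loc x₀) z))
        (locForm (S.divRicci α) x₀ z) a b) := by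
  have hop := isOpen_chartDom x₀ hA
  have hzs := chartDom_mono hAs x₀ hz
  exact extD_dJFun_sq
    (β := fun v => (locForm (S.divRicci α) x₀ v).comp (almostCpx (S.loc x₀) v))
    (Filter.mem_of_superset (hop.mem_nhds hz) fun w hw => hasFDerivAt_exp hA hf hF hw)
    (Filter.mem_of_superset (hop.mem_nhds hz) fun w hw =>
      h.potential_comp_tangentStr (chartDom_mono hAs x₀ hw))
    ((h.isSemibasicOn x₀).differentiableAt (isOpen_chartDom x₀ isOpen_slit) hzs) a b

theorem isConicFinsler (h : ParallelIsotropic S α) (hreg : S.RegularForm (S.divRicci α))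
    (hA : IsConicRegion A) (hf : S.HasPotential (S.divRicci α) A f)
    (hF : ∀ p ∈ A, F p = Real.exp (f p)) : IsConicFinsler A F where
  smooth := by
    refine ContMDiffOn.congr (f := fun p => Real.exp (f p)) ?_ hF
    exact fun p hp => Real.contDiff_exp.contMDiff.contMDiffAt.comp_contMDiffWithinAt p
      (h.contMDiffOn_potential hA.isOpen hA.subset hf p hp)
  pos := fun p hp => by rw [hF p hp]; exact Real.exp_pos _
  homogeneous := fun p hp c hc => by
    rw [hF p hp, hF _ (hA.scale_mem p hp c hc), h.potential_scale hA hf hp hc, Real.exp_add,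
      Real.exp_log hc, mul_comm]
  symplectic := fun x₀ z hz a hab => by
    refine hreg x₀ z (chartDom_mono hA.subset x₀ hz) a fun b => ?_
    have h1 := hab b
    rw [h.ddJSq_eq hA.isOpen hA.subset hf hF hz] at h1
    have h2 : 2 * locFun F x₀ z ^ 2 ≠ 0 := by
      have : 0 < locFun F x₀ z := by rw [locFun, hF _ hz.2]; exact Real.exp_pos _
      positivity
    exact (mul_eq_zero.1 h1).resolve_left h2

theorem isGeodesicOf (h : ParallelIsotropic S α)
    (hA : IsConicRegion A) (hf : S.HasPotential (S.divRicci α) A f)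
    (hF : ∀ p ∈ A, F p = Real.exp (f p)) : S.IsGeodesicOf A F := by
  intro x₀ z hz b
  have hzs := chartDom_mono hA.subset x₀ hz
  have hS := S.isLocalSpray x₀ (isOpen_slit (n := n) (M := M)) subset_rfl
  have e1 : locForm (S.divRicci α) x₀ z (S.loc x₀ z) = 1 := by
    rw [← Prod.mk.eta (p := S.loc x₀ z), hS.fst_apply hzs, (h.isSemibasicOn x₀).apply_eq hzs,
      h.apply_liouville hzs]
  have e2 : ((locForm (S.divRicci α) x₀ z).comp (almostCpx (S.loc x₀) z)) (S.loc x₀ z) = 0 := by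
    rw [h.comp_almostCpx_eq hzs, extD, sub_self]
  rw [h.ddJSq_eq hA.isOpen hA.subset hf hF hz, wedge, ← h.comp_almostCpx_eq hzs, e1, e2,
    ((hasFDerivAt_exp hA.isOpen hf hF hz).pow 2).fderiv]
  simp
  ring

theorem nonvanishingScalarFlag (h : ParallelIsotropic S α)
    (hA : IsConicRegion A) (hf : S.HasPotential (S.divRicci α) A f)
    (hF : ∀ p ∈ A, F p = Real.exp (f p)) (hFc : IsConicFinsler A F) :
    S.NonvanishingScalarFlag A F := by
  refine ⟨fun p => S.ricci p * (F p ^ 2)⁻¹, ?_, ?_, ?_⟩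
  · intro p hp
    have hps := mem_natChart_source_self p
    have hzA := natChart_mem_chartDom hp hps
    refine (contMDiffAt_of_locFun hps ?_).contMDiffWithinAt
    have h1 := (h.isotropic.contDiffOn_ricci p.1).contDiffAt
      ((isOpen_chartDom p.1 isOpen_slit).mem_nhds (chartDom_mono hA.subset p.1 hzA))
    have h2 := (contDiffOn_locFun hA.isOpen hFc.smooth p.1).contDiffAt
      ((isOpen_chartDom p.1 hA.isOpen).mem_nhds hzA)
    refine h1.mul ((h2.pow 2).inv ?_)
    exact pow_ne_zero 2 (hFc.pos _ hzA.2).ne'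
  · intro p hp
    exact mul_ne_zero (h.ricci_ne_zero p (hA.subset hp))
      (inv_ne_zero (pow_ne_zero 2 (hFc.pos p hp).ne'))
  · intro x₀ z hz
    have hzs := chartDom_mono hA.subset x₀ hz
    have hFz : locFun F x₀ z ≠ 0 := (hFc.pos _ hz.2).ne'
    have hρ : locFun S.ricci x₀ z ≠ 0 := h.ricci_ne_zero _ hzs.2
    have e1 : dJFun (locFun F x₀) z = locFun F x₀ z • locForm (S.divRicci α) x₀ z := by
      rw [dJFun, (hasFDerivAt_exp hA.isOpen hf hF hz).fderiv, ContinuousLinearMap.smul_comp,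
        h.potential_comp_tangentStr hzs]
    have e2 : locFun (fun p => S.ricci p * (F p ^ 2)⁻¹) x₀ z
        = locFun S.ricci x₀ z * (locFun F x₀ z ^ 2)⁻¹ := rfl
    rw [h.isotropic.jacobi x₀ z hzs, e1, e2, locForm_divRicci]
    refine ContinuousLinearMap.ext fun u => ?_
    simp only [sub_apply, smul_apply, ContinuousLinearMap.smulRight_apply, smul_sub, smul_smul,
      smul_eq_mul]
    congr 2 <;> field_simp

end

end ParallelIsotropic

end Spray

end

/-! ### Existence of potentials -/

section

variable {n : ℕ} {M : Type*} [TopologicalSpace M] [ChartedSpace (Base n) M]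
  [IsManifold 𝓘(ℝ, Base n) ∞ M] {x₀ : M} {z : Tot n} {A : Set (TM n M)}

/-- The part of the domain of the natural chart at `x₀` that corresponds to `D`. -/
def chartRegion (x₀ : M) (D : Set (Tot n)) : Set (TM n M) :=
  (natChart (n := n) x₀).source ∩ natChart x₀ ⁻¹' D

theorem isConicRegion_chartRegion {D : Set (Tot n)} (hD : IsOpen D)
    (hD0 : D ⊆ chartDom x₀ (slit : Set (TM n M)))
    (hDs : ∀ z ∈ D, ∀ c : ℝ, 0 < c → ((z.1, c • z.2) : Tot n) ∈ D) :
    IsConicRegion (chartRegion (M := M) x₀ D) where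
  isOpen := ContinuousOn.isOpen_inter_preimage (fun _ hp =>
    (contMDiffAt_natChart hp).continuousAt.continuousWithinAt) (isOpen_natChart_source x₀) hD
  subset := fun p hp => by
    have := (hD0 hp.2).2
    rwa [PartialEquiv.left_inv _ hp.1] at this
  scale_mem := fun p hp c hc => ⟨mem_natChart_source.2 (mem_natChart_source.1 hp.1), by
    rw [Set.mem_preimage, natChart_scale]
    exact hDs _ hp.2 c hc⟩

namespace Spray

variable {S : Spray n M} {α : OneForm n M}

namespace ParallelIsotropic

/-- A primitive of `θ ∘ 𝔽` in one chart is one in every chart. -/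
theorem hasPotential_chartRegion (h : ParallelIsotropic S α) {D : Set (Tot n)}
    (hD0 : D ⊆ chartDom x₀ (slit : Set (TM n M))) {g : Tot n → ℝ}
    (hg : ∀ z ∈ D, HasFDerivAt g
      ((locForm (S.divRicci α) x₀ z).comp (almostCpx (S.loc x₀) z)) z) :
    S.HasPotential (S.divRicci α) (chartRegion x₀ D) (fun p => g (natChart x₀ p)) := by
  intro x₁ z hz
  have hz1 := hz.2.1
  have hzD : chartTrans x₁ x₀ z ∈ D := hz.2.2
  have hzs : z ∈ chartDom x₁ (slit : Set (TM n M)) := by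
    refine ⟨hz.1, ?_⟩
    have := (hD0 hzD).2
    rwa [natChart_symm_chartTrans hz1] at this
  rw [h.comp_almostCpx_chartTrans hzs hz1]
  exact (hg _ hzD).comp z
    ((contDiffAt_chartTrans hz.1 hz1).differentiableAt (by simp)).hasFDerivAt

theorem metrizable (h : ParallelIsotropic S α) (hreg : S.RegularForm (S.divRicci α))
    (hA : IsConicRegion A) {f : TM n M → ℝ} (hf : S.HasPotential (S.divRicci α) A f)
    {F : TM n M → ℝ} (hF : ∀ p ∈ A, F p = Real.exp (f p)) :
    IsConicFinsler A F ∧ S.IsGeodesicOf A F ∧ S.NonvanishingScalarFlag A F :=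
  have hFc := h.isConicFinsler hreg hA hf hF
  ⟨hFc, h.isGeodesicOf hA hf hF, h.nonvanishingScalarFlag hA hf hF hFc⟩

theorem metrizableOver (h : ParallelIsotropic S α) (hreg : S.RegularForm (S.divRicci α))
    {U : Set M} (hU : IsOpen U) {f : TM n M → ℝ}
    (hf : S.HasPotential (S.divRicci α) (slitOver U) f) : S.MetrizableOver U := by
  classical
  obtain ⟨h1, h2, h3⟩ := h.metrizable hreg (isConicRegion_slitOver hU) hf
    (F := fun p => if p.2 = 0 then 0 else Real.exp (f p)) fun p hp => if_neg hp.2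
  exact ⟨_, ⟨continuousOn_of_homogeneous hU h1.smooth.continuousOn (fun x _ => if_pos rfl)
    h1.homogeneous, fun x _ => if_pos rfl, h1⟩, h2, h3⟩

theorem differentiableOn_potential (h : ParallelIsotropic S α) (x₀ : M) :
    DifferentiableOn ℝ (fun v => (locForm (S.divRicci α) x₀ v).comp (almostCpx (S.loc x₀) v))
      (chartDom x₀ (slit (n := n))) :=
  (h.contDiffOn_potential x₀).differentiableOn (by simp)

theorem exists_metrizableOnConic (h : ParallelIsotropic S α)
    (hreg : S.RegularForm (S.divRicci α)) {p : TM n M} (hp : p ∈ slit (n := n) (M := M)) :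
    ∃ A : Set (TM n M), IsConicRegion A ∧ p ∈ A ∧ S.MetrizableOnConic A := by
  have hps := mem_natChart_source_self p
  set z := natChart p.1 p with hz
  have hz2 : z.2 ≠ 0 := fun h0 => hp ((natChart_snd_eq_zero hps).1 h0)
  obtain ⟨r, hr, hball⟩ := Metric.isOpen_iff.1 (chartAt (Base n) p.1).open_target z.1
    (mem_natChart_target.1 (PartialEquiv.map_source _ hps))
  set D : Set (Tot n) := Metric.ball z.1 r ×ˢ {y : Base n | 0 < inner ℝ z.2 y} with hD
  have hDo : IsOpen D := Metric.isOpen_ball.prod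
    (isOpen_lt continuous_const (by fun_prop))
  have hDc : Convex ℝ D := (convex_ball _ _).prod
    (convex_halfSpace_gt (innerₛₗ ℝ z.2).isLinear 0)
  have hD0 : D ⊆ chartDom p.1 (slit : Set (TM n M)) := fun w hw => by
    have hwt : w ∈ (natChart (n := n) p.1).target := mem_natChart_target.2 (hball hw.1)
    refine ⟨hwt, (natChart_symm_mem_slit hwt).2 fun h0 => ?_⟩
    have h1 : 0 < inner ℝ z.2 w.2 := hw.2
    rw [h0, inner_zero_right] at h1
    exact lt_irrefl _ h1
  obtain ⟨g, hg⟩ := hDc.exists_forall_hasFDerivAt_of_fderiv_symmetric hDo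
    ((h.differentiableOn_potential p.1).mono hD0)
    fun w hw a b => sub_eq_zero.1 (h.extD_potential (hD0 hw) a b)
  have hA : IsConicRegion (chartRegion p.1 D) := isConicRegion_chartRegion hDo hD0
    fun w hw c hc => ⟨hw.1, by
      have h1 : 0 < inner ℝ z.2 w.2 := hw.2
      change 0 < inner ℝ z.2 (c • w.2)
      rw [inner_smul_right]
      positivity⟩
  refine ⟨_, hA, ⟨hps, Metric.mem_ball_self hr, real_inner_self_pos.2 hz2⟩,
    fun q => Real.exp (g (natChart p.1 q)), ?_⟩
  exact h.metrizable hreg hA (h.hasPotential_chartRegion hD0 hg) fun _ _ => rfl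

theorem exists_metrizableOver (h : ParallelIsotropic S α) (hn : 3 ≤ n)
    (hreg : S.RegularForm (S.divRicci α)) (x : M) :
    ∃ U : Set M, IsOpen U ∧ x ∈ U ∧ S.MetrizableOver U := by
  obtain ⟨r, hr, hball⟩ := Metric.isOpen_iff.1 (chartAt (Base n) x).open_target
    (chartAt (Base n) x x) (mem_chart_target _ _)
  set B := Metric.ball (chartAt (Base n) x x) r with hB
  have hD0 : B ×ˢ {0}ᶜ ⊆ chartDom x (slit : Set (TM n M)) := fun w hw => by
    have hwt : w ∈ (natChart (n := n) x).target := mem_natChart_target.2 (hball hw.1)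
    exact ⟨hwt, (natChart_symm_mem_slit hwt).2 hw.2⟩
  obtain ⟨g, hg⟩ := exists_primitive_prod_compl_zero hn (convex_ball _ _) Metric.isOpen_ball
    ((h.differentiableOn_potential x).mono hD0)
    fun w hw a b => sub_eq_zero.1 (h.extD_potential (hD0 hw) a b)
  set U : Set M := (chartAt (Base n) x).source ∩ chartAt (Base n) x ⁻¹' B with hU
  have hUo : IsOpen U := (chartAt (Base n) x).isOpen_inter_preimage Metric.isOpen_ball
  refine ⟨U, hUo, ⟨mem_chart_source _ _, Metric.mem_ball_self hr⟩,
    h.metrizableOver hreg hUo (f := fun p => g (natChart x p)) ?_⟩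
  have h1 : slitOver U = chartRegion x (B ×ˢ {0}ᶜ) := by
    ext p
    constructor
    · intro hp
      have hps : p ∈ (natChart (n := n) x).source := mem_natChart_source.2 hp.1.1
      exact ⟨hps, hp.1.2, fun h0 => hp.2 ((natChart_snd_eq_zero hps).1 h0)⟩
    · intro hp
      exact ⟨⟨mem_natChart_source.1 hp.1, hp.2.1⟩,
        fun h0 => hp.2.2 ((natChart_snd_eq_zero hp.1).2 h0)⟩
  rw [h1]
  exact h.hasPotential_chartRegion hD0 hg

theorem metrizableOver_univ (h : ParallelIsotropic S α) (hreg : S.RegularForm (S.divRicci α))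
    (hH : SlitH1Vanishes n M) : S.MetrizableOver Set.univ := by
  have hop := fun x₀ : M => isOpen_chartDom x₀ (isOpen_slit (n := n) (M := M))
  obtain ⟨f, hf, hdf⟩ := hH (S.potentialForm (S.divRicci α))
    (fun x₀ => (h.contDiffOn_potential x₀).congr fun z hz => h.locForm_potentialForm hz)
    (fun x₀ z hz a b => by
      have h1 : locForm (S.potentialForm (S.divRicci α)) x₀ =ᶠ[nhds z]
          fun v => (locForm (S.divRicci α) x₀ v).comp (almostCpx (S.loc x₀) v) := by
        filter_upwards [(hop x₀).mem_nhds hz] with w hw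
        exact h.locForm_potentialForm hw
      have h2 := h.extD_potential hz a b
      rw [extD] at h2 ⊢
      rw [h1.fderiv_eq, h2])
  refine h.metrizableOver hreg isOpen_univ (f := f) fun x₀ z hz => ?_
  have hzs := chartDom_mono (slitOver_subset _) x₀ hz
  rw [← h.locForm_potentialForm hzs, hdf x₀ z hzs]
  exact (((contDiffOn_locFun isOpen_slit hf x₀).contDiffAt
    ((hop x₀).mem_nhds hzs)).differentiableAt (by simp)).hasFDerivAt

end ParallelIsotropic

theorem fourConditions_of_metrizableOver (S : Spray n M) (hn : 2 ≤ n)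
    (H : ∀ x : M, ∃ U : Set M, IsOpen U ∧ x ∈ U ∧ S.MetrizableOver U) : S.FourConditions := by
  refine S.fourConditions_of_conic hn fun p hp => ?_
  obtain ⟨U, hU, hx, F, hF, hG, hk⟩ := H p.1
  exact ⟨slitOver U, isConicRegion_slitOver hU, ⟨hx, hp⟩, F, hF.conic, hG, hk⟩

end Spray

end

end SprayGeom

end

theorem theorem3p1 (n : ℕ) (hn : 2 ≤ n) (M : Type*) [TopologicalSpace M]
    [ChartedSpace (SprayGeom.Base n) M] [IsManifold 𝓘(ℝ, SprayGeom.Base n) ∞ M]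
    (S : SprayGeom.Spray n M)
    (hρ : ∀ p ∈ SprayGeom.slit (n := n) (M := M), S.ricci p ≠ 0) :
    -- necessity, for a Finsler function on all of `TM`
    (S.MetrizableOver Set.univ → S.FourConditions) ∧
    -- sufficiency for a Finsler function on all of `TM`, if there is no topological obstruction
    (SprayGeom.SlitH1Vanishes n M → S.FourConditions → S.MetrizableOver Set.univ) ∧
    -- local characterization by conic pseudo-Finsler functions
    ((∀ p ∈ SprayGeom.slit (n := n) (M := M), ∃ A : Set (SprayGeom.TM n M),
        SprayGeom.IsConicRegion A ∧ p ∈ A ∧ S.MetrizableOnConic A) ↔ S.FourConditions) ∧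
    -- local characterization by Finsler functions
    (3 ≤ n → ((∀ x : M, ∃ U : Set M, IsOpen U ∧ x ∈ U ∧ S.MetrizableOver U) ↔
        S.FourConditions)) := by
  refine ⟨fun h => S.fourConditions_of_metrizableOver hn
    fun _ => ⟨Set.univ, isOpen_univ, Set.mem_univ _, h⟩, ?_,
    ⟨S.fourConditions_of_conic hn, ?_⟩,
    fun hn3 => ⟨S.fourConditions_of_metrizableOver hn, ?_⟩⟩
  · rintro hH ⟨α, hα, hJ, hP, hreg⟩
    exact SprayGeom.Spray.ParallelIsotropic.metrizableOver_univ ⟨hρ, hα, hJ, hP⟩ hreg hH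
  · rintro ⟨α, hα, hJ, hP, hreg⟩ p hp
    exact SprayGeom.Spray.ParallelIsotropic.exists_metrizableOnConic ⟨hρ, hα, hJ, hP⟩ hreg hp
  · rintro ⟨α, hα, hJ, hP, hreg⟩ x
    exact SprayGeom.Spray.ParallelIsotropic.exists_metrizableOver ⟨hρ, hα, hJ, hP⟩ hn3 hreg x
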